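/- Let $\lambda\ge 0$, $a\in\mathbb R$, mass $M=1$, and $\Delta_r=(1-\lambda r^2)(r^2+a^2)-2r$. Assume the parameters are subextreme: $\Delta_r$ has exactly three distinct positive roots $r_-<r_+<r_c$ (if $\lambda>0$), respectively exactly two, $r_-<r_+$ (if $\lambda=0$; then put $r_c=\infty$). Let $(\mathcal M,g)$ be the physical Kerr ($\lambda=0$) or Kerr–de Sitter ($\lambda>0$) spacetime, i.e. the block $\{r_-<r<r_+\}$, the future event horizon, the exterior $\mathrm M_{\rm I}=\{r_+<r<r_c\}$ and, for $\lambda>0$, the future cosmological horizon and the block $\{r>r_c\}$, with signature $(-,+,+,+)$. It is time-oriented in Boyer–Lindquist coordinates $(t,r,\theta,\varphi)$ by $-\partial_r$, $-\nabla t$, $\partial_r$ on the three blocks, respectively, and by continuity on the horizons. A null covector $k\ne0$ is called future-directed if $k$ is positive on future-directed timelike vectors. Let $v_+=\partial_t+\frac{a}{r_+^2+a^2}\partial_\varphi$ and $v_c=\partial_t+\frac{a}{r_c^2+a^2}\partial_\varphi$ (with $v_c=\partial_t$ if $\lambda=0$) be the Killing fields generating the event and the cosmological horizon. Let $\Gamma^{+}$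 (resp. $\Gamma^-$) be the set of $(x,k)\in T^*\mathcal M$ for which the affinely parametrized null geodesic $\gamma$ through $x$ with velocity $g^{-1}(k,\cdot)\neq0$ at $x$ exists up to parameter $+\infty$ (resp. down to $-\infty$) and satisfies $r_+<r_0<r(\gamma(\tau))<R_0<r_c$ for some constants $r_0,R_0$ and all sufficiently large (resp. sufficiently small) $\tau$. Put $\Gamma=\Gamma^+\cup\Gamma^-$. Finally, for $a\in\mathbb R$ let $\lambda_0(a)\in[0,\infty]$ be the infimum of all $\lambda$ such that $(a,\lambda)$ is subextreme and there is $r_m\in(r_+,r_c)$ with $\partial_r\Delta_r(r_m)=0$ and $\Delta_r(r_m)=a^2$ (with $\inf\emptyset=\infty$). Then $\lambda_0(a)$ is bounded below by a positive constant independent of $a$. Moreover, for all subextreme $(a,\lambda)$ with $0\le\lambda<\lambda_0(a)$: if $(x,k)\in\Gamma$ and $k(v_+)\ge0$ or $k(v_c)\ge0$, then $k$ is a future-directed null covector. -/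

import Mathlib

/-- Parameters of a subextreme Kerr (`lam = 0`) or Kerr–de Sitter (`lam > 0`) spacetime of mass `1`,
where `lam = Λ / 3`, together with its horizon radii: `Δ_r = (1 - lam r²)(r² + a²) - 2 r` has exactly
two (`lam = 0`), resp. three (`lam > 0`), distinct positive roots. For `lam = 0` there is no
cosmological horizon (`r_c = ∞`), and the value of the field `rC` is never used. -/
structure KerrDeSitter where
  a : ℝ
  lam : ℝ
  rMinus : ℝ
  rPlus : ℝ
  rC : ℝ
  lam_nonneg : 0 ≤ lam
  rMinus_pos : 0 < rMinus
  rMinus_lt_rPlus : rMinus < rPlus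
  rPlus_lt_rC : 0 < lam → rPlus < rC
  roots_kerr : lam = 0 →
    {r : ℝ | 0 < r ∧ (1 - lam * r ^ 2) * (r ^ 2 + a ^ 2) - 2 * r = 0} = {rMinus, rPlus}
  roots_deSitter : 0 < lam →
    {r : ℝ | 0 < r ∧ (1 - lam * r ^ 2) * (r ^ 2 + a ^ 2) - 2 * r = 0} = {rMinus, rPlus, rC}

/-- The ambient coordinate space `ℝ_t × ℝ³`; the angular variable is `ω = y / |y| ∈ S²`, and `r = |y|`.
This also covers the rotation axis. -/
abbrev Coord : Type := ℝ × EuclideanSpace ℝ (Fin 3)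

namespace KerrDeSitter

noncomputable section

variable (S : KerrDeSitter)

/-- `r_+ < r < r_c`, where `r_c = ∞` if `lam = 0`: the radii of the exterior block `M_I`. -/
def InExterior (r : ℝ) : Prop := S.rPlus < r ∧ (0 < S.lam → r < S.rC)

/-- `Δ_r`. -/
def deltaR (r : ℝ) : ℝ := (1 - S.lam * r ^ 2) * (r ^ 2 + S.a ^ 2) - 2 * r

/-- `χ = 1 + lam a²`. -/
def chi : ℝ := 1 + S.lam * S.a ^ 2

/-- The threshold `λ₀(a)`: the infimum of the `lam` for which the subextreme spacetime with rotation parameter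
`a` has a critical point `r_m ∈ (r_+, r_c)` of `Δ_r` with `Δ_r(r_m) = a²` (and `+∞` if there is no
such `lam`). -/
def lambda0 (a : ℝ) : EReal :=
  sInf {L : EReal | ∃ S : KerrDeSitter, S.a = a ∧ L = (S.lam : EReal) ∧
    ∃ rm : ℝ, S.InExterior rm ∧ S.deltaR rm = a ^ 2 ∧ deriv S.deltaR rm = 0}

/-! ### The physical spacetime

The physical spacetime `M_II ∪ H_+^R ∪ M_I (∪ H_c^L ∪ M_III)` is covered by the coordinates
`(t*, r, ω) ∈ ℝ × (r_-, ∞) × S²` which are regular at both future horizons and are related to the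
Boyer–Lindquist coordinates of each block by
`dt* = dt + s χ (r² + a²) / Δ_r dr`, `dφ* = dφ + s χ a / Δ_r dr`,
where `s(r_+) = 1` (ingoing at the event horizon) and `s(r_c) = -1` (outgoing at the cosmological
horizon). For `lam = 0` these are the usual ingoing Kerr coordinates (`s = 1`). -/

/-- The function `s`. -/
def sFun (r : ℝ) : ℝ :=
  if S.lam = 0 then 1 else (S.rPlus + S.rC - 2 * r) / (S.rC - S.rPlus)

/-- The smooth extension of `(s² - 1) / Δ_r` through the horizons; recall that
`Δ_r = -lam (r - r_-) (r - r_+) (r - r_c) (r + r_- + r_+ + r_c)` for `lam > 0`. -/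
def wFun (r : ℝ) : ℝ :=
  if S.lam = 0 then 0 else
    -4 / (S.lam * (r - S.rMinus) * (r + S.rMinus + S.rPlus + S.rC) * (S.rC - S.rPlus) ^ 2)

end

end KerrDeSitter

namespace Coord

noncomputable section

/-- The radius `r`. -/
def rad (x : Coord) : ℝ := ‖x.2‖

/-- `cos² θ`. -/
def cosSq (x : Coord) : ℝ := (x.2 2) ^ 2 / x.rad ^ 2

/-- `sin² θ`. -/
def sinSq (x : Coord) : ℝ := ((x.2 0) ^ 2 + (x.2 1) ^ 2) / x.rad ^ 2

/-- The one-form `dr`. -/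
def dr (x u : Coord) : ℝ := inner ℝ x.2 u.2 / x.rad

/-- The one-form `sin² θ dφ*`. -/
def dphi (x u : Coord) : ℝ := (x.2 0 * u.2 1 - x.2 1 * u.2 0) / x.rad ^ 2

/-- The coordinate vector field `∂_t`, which is the same in the coordinates `(t*, r, θ, φ*)` and in
Boyer–Lindquist coordinates. -/
def ddt : Coord := (1, 0)

/-- The coordinate vector field `∂_φ`, which is the same in the coordinates `(t*, r, θ, φ*)` and in
Boyer–Lindquist coordinates. -/
def ddphi (x : Coord) : Coord := (0, !₂[-(x.2 1), x.2 0, 0])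

/-- The coordinate vector field `∂_r` of the coordinates `(t*, r, θ, φ*)`. -/
def ddr (x : Coord) : Coord := (0, x.rad⁻¹ • x.2)

end

end Coord

namespace KerrDeSitter

noncomputable section

variable (S : KerrDeSitter)

/-- The physical spacetime, as an open subset of the coordinate space. -/
def spacetime : Set Coord := {x | S.rMinus < x.rad}

/-- `ρ²`. -/
def rhoSq (x : Coord) : ℝ := x.rad ^ 2 + S.a ^ 2 * x.cosSq

/-- `Δ_θ`. -/
def deltaTheta (x : Coord) : ℝ := 1 + S.lam * S.a ^ 2 * x.cosSq

/-- `μ`. -/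
def mu (x : Coord) : ℝ := (x.rad ^ 2 + S.a ^ 2) * S.deltaTheta x - S.deltaR x.rad

/-- `σ²`. -/
def sigmaSq (x : Coord) : ℝ :=
  (x.rad ^ 2 + S.a ^ 2) ^ 2 * S.deltaTheta x - S.a ^ 2 * x.sinSq * S.deltaR x.rad

/-- The one-form `τ = dt* - a sin² θ dφ*`. -/
def tauForm (x u : Coord) : ℝ := u.1 - S.a * x.dphi u

/-- The metric of the physical spacetime. In the coordinates `(t*, r, θ, φ*)` it reads
`g = -Δ_r / (χ² ρ²) τ² + (2 s / χ) τ dr - ρ² w dr²`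
`    + Δ_θ sin² θ / (χ² ρ²) (a dt* - (r² + a²) dφ*)² + ρ² / Δ_θ dθ²`,
with `w = (s² - 1) / Δ_r`. The second line is written below in a form which is smooth at the axis,
using `dθ² + sin² θ dφ*² = (|dy|² - dr²) / r²` and
`Δ_θ (r² + a²) - χ ρ² = a² sin² θ (1 - lam r²)`. -/
def metric (x u v : Coord) : ℝ :=
  -(S.deltaR x.rad / (S.chi ^ 2 * S.rhoSq x)) * (S.tauForm x u * S.tauForm x v)
  + S.sFun x.rad / S.chi * (S.tauForm x u * x.dr v + x.dr u * S.tauForm x v)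
  - S.rhoSq x * S.wFun x.rad * (x.dr u * x.dr v)
  + S.deltaTheta x / (S.chi ^ 2 * S.rhoSq x) *
      (S.a ^ 2 * x.sinSq * (u.1 * v.1)
        - S.a * (x.rad ^ 2 + S.a ^ 2) * (u.1 * x.dphi v + x.dphi u * v.1))
  + S.a ^ 2 * (1 - S.lam * x.rad ^ 2)
      * (S.deltaTheta x * (x.rad ^ 2 + S.a ^ 2) + S.chi * S.rhoSq x)
      / (S.chi ^ 2 * S.rhoSq x * S.deltaTheta x) * (x.dphi u * x.dphi v)
  + S.rhoSq x / (S.deltaTheta x * x.rad ^ 2) * (inner ℝ u.2 v.2 - x.dr u * x.dr v)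

/-- The Boyer–Lindquist form of the metric, evaluated on a tangent vector with components
`(dt, dr, dθ, dφ)` at a point with coordinates `r`, `θ`. -/
def metricBL (r θ dt dr dθ dφ : ℝ) : ℝ :=
  let ρ2 := r ^ 2 + S.a ^ 2 * Real.cos θ ^ 2
  let Dθ := 1 + S.lam * S.a ^ 2 * Real.cos θ ^ 2
  let μ := (r ^ 2 + S.a ^ 2) * Dθ - S.deltaR r
  let σ2 := (r ^ 2 + S.a ^ 2) ^ 2 * Dθ - S.a ^ 2 * Real.sin θ ^ 2 * S.deltaR r
  (Dθ * S.a ^ 2 * Real.sin θ ^ 2 - S.deltaR r) / (S.chi ^ 2 * ρ2) * dt ^ 2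
    + σ2 * Real.sin θ ^ 2 / (S.chi ^ 2 * ρ2) * dφ ^ 2
    + ρ2 / S.deltaR r * dr ^ 2 + ρ2 / Dθ * dθ ^ 2
    - 2 * (S.a * Real.sin θ ^ 2 * μ / (S.chi ^ 2 * ρ2)) * dt * dφ

/-- `wFun` is `(s² - 1) / Δ_r` away from the horizons. -/
theorem wFun_eq {r : ℝ} (hr : S.rMinus < r) (hD : S.deltaR r ≠ 0) :
    S.wFun r = (S.sFun r ^ 2 - 1) / S.deltaR r := by
  unfold wFun sFun
  split_ifs with h
  · simp
  · have hl : 0 < S.lam := lt_of_le_of_ne S.lam_nonneg (Ne.symm h)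
    have h1 := S.rMinus_pos
    have h2 := S.rMinus_lt_rPlus
    have h3 := S.rPlus_lt_rC hl
    have hs := S.roots_deSitter hl
    have e1 : S.rMinus ∈ {r : ℝ | 0 < r ∧ (1 - S.lam * r ^ 2) * (r ^ 2 + S.a ^ 2) - 2 * r = 0} := by
      rw [hs]; simp
    have e2 : S.rPlus ∈ {r : ℝ | 0 < r ∧ (1 - S.lam * r ^ 2) * (r ^ 2 + S.a ^ 2) - 2 * r = 0} := by
      rw [hs]; simp
    have e3 : S.rC ∈ {r : ℝ | 0 < r ∧ (1 - S.lam * r ^ 2) * (r ^ 2 + S.a ^ 2) - 2 * r = 0} := by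
      rw [hs]; simp
    obtain ⟨-, e1⟩ := e1
    obtain ⟨-, e2⟩ := e2
    obtain ⟨-, e3⟩ := e3
    set p := S.rMinus
    set q := S.rPlus
    set c := S.rC
    set l := S.lam
    have f1 : (1 - l * S.a ^ 2) * (q + p) - l * (q ^ 2 + p ^ 2) * (q + p) = 2 := by
      have : (q - p) * ((1 - l * S.a ^ 2) * (q + p) - l * (q ^ 2 + p ^ 2) * (q + p) - 2) = 0 := by
        linear_combination e2 - e1
      have := (mul_eq_zero.mp this).resolve_left (by linarith)
      linarith
    have f2 : (1 - l * S.a ^ 2) * (c + p) - l * (c ^ 2 + p ^ 2) * (c + p) = 2 := by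
      have : (c - p) * ((1 - l * S.a ^ 2) * (c + p) - l * (c ^ 2 + p ^ 2) * (c + p) - 2) = 0 := by
        linear_combination e3 - e1
      have := (mul_eq_zero.mp this).resolve_left (by linarith)
      linarith
    have f3 : 1 - l * S.a ^ 2 = l * (c ^ 2 + q ^ 2 + p ^ 2 + c * q + c * p + q * p) := by
      have : (c - q) * (1 - l * S.a ^ 2 - l * (c ^ 2 + q ^ 2 + p ^ 2 + c * q + c * p + q * p)) = 0 := by
        linear_combination f2 - f1
      have := (mul_eq_zero.mp this).resolve_left (by linarith)
      linarith
    have fac : S.deltaR r = -l * (r - p) * (r - q) * (r - c) * (r + p + q + c) := by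
      unfold deltaR
      change (1 - l * r ^ 2) * (r ^ 2 + S.a ^ 2) - 2 * r = _
      linear_combination e1 + (r - p) * f1 + (r - p) * (r - q) * f3
    rw [fac] at hD ⊢
    have g1 : r - q ≠ 0 := by rintro h; simp [h] at hD
    have g2 : r - c ≠ 0 := by rintro h; simp [h] at hD
    have g3 : r - p ≠ 0 := by linarith
    have g4 : r + p + q + c ≠ 0 := by linarith
    have g5 : c - q ≠ 0 := by linarith
    field_simp
    ring

/-- On each block (`Δ_r ≠ 0`), the coordinates `(t*, r, ω)` turn `metric` into the Boyer–Lindquist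
metric; `x` is a point with spherical coordinates `(t, r, θ, φ)` and `u` the tangent vector with
Boyer–Lindquist components `(dt, dr, dθ, dφ)`. -/
theorem metric_eq_metricBL (t r θ φ dt dr dθ dφ : ℝ)
    (hr : S.rMinus < r) (hD : S.deltaR r ≠ 0) :
    let dφ' := dφ + S.sFun r * S.chi * S.a / S.deltaR r * dr
    let x : Coord := (t, !₂[r * Real.sin θ * Real.cos φ, r * Real.sin θ * Real.sin φ, r * Real.cos θ])
    let u : Coord := (dt + S.sFun r * S.chi * (r ^ 2 + S.a ^ 2) / S.deltaR r * dr,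
      !₂[dr * Real.sin θ * Real.cos φ + dθ * r * Real.cos θ * Real.cos φ
          - dφ' * r * Real.sin θ * Real.sin φ,
        dr * Real.sin θ * Real.sin φ + dθ * r * Real.cos θ * Real.sin φ
          + dφ' * r * Real.sin θ * Real.cos φ,
        dr * Real.cos θ - dθ * r * Real.sin θ])
    S.metric x u u = S.metricBL r θ dt dr dθ dφ := by
  intro dφ' x u
  have r0 : 0 < r := S.rMinus_pos.trans hr
  have hsc := Real.sin_sq_add_cos_sq θ
  have hsp := Real.sin_sq_add_cos_sq φ
  have hrad : x.rad = r := by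
    simp only [Coord.rad, x, EuclideanSpace.norm_eq, Fin.sum_univ_three, Real.norm_eq_abs, sq_abs]
    rw [Real.sqrt_eq_iff_mul_self_eq_of_pos r0]
    simp
    linear_combination -r ^ 2 * (Real.sin θ) ^ 2 * hsp - r ^ 2 * hsc
  have hcos : x.cosSq = Real.cos θ ^ 2 := by
    simp only [Coord.cosSq, hrad]; simp [x]; field_simp
  have hsin : x.sinSq = Real.sin θ ^ 2 := by
    simp only [Coord.sinSq, hrad]; simp [x]; field_simp
    linear_combination (Real.sin θ) ^ 2 * hsp
  have hdr : x.dr u = dr := by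
    simp only [Coord.dr, hrad]; simp [x, u, PiLp.inner_apply, Fin.sum_univ_three]; field_simp
    linear_combination (Real.sin θ^2 * dr + Real.sin θ * dθ * r * Real.cos θ) * hsp + dr * hsc
  have hdphi : x.dphi u = Real.sin θ ^ 2 * dφ' := by
    simp only [Coord.dphi, hrad]; simp only [x, u]
    generalize dφ' = e
    simp; field_simp
    linear_combination (Real.sin θ) ^ 2 * r * e * hsp
  have hin : inner ℝ u.2 u.2 = dr ^ 2 + r ^ 2 * (dθ ^ 2 + Real.sin θ ^ 2 * dφ' ^ 2) := by
    simp only [u, PiLp.inner_apply, Fin.sum_univ_three]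
    generalize dφ' = e
    simp
    linear_combination (Real.sin θ^2 * dr^2 + 2 * dr * dθ * r * Real.sin θ * Real.cos θ
      + dθ^2 * r^2 * Real.cos θ^2 + e^2 * r^2 * Real.sin θ^2) * hsp + (dr^2 + dθ^2*r^2) * hsc
  have hc : 0 < S.chi := by
    have := S.lam_nonneg
    unfold chi; positivity
  have hT : 0 < 1 + S.lam * S.a ^ 2 * Real.cos θ ^ 2 := by
    have := S.lam_nonneg
    positivity
  have hR : 0 < r ^ 2 + S.a ^ 2 * Real.cos θ ^ 2 := by positivity
  simp only [metric, metricBL, tauForm, rhoSq,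
    deltaTheta, hrad, hcos, hsin, hdr, hdphi, hin, S.wFun_eq hr hD]
  simp only [u, dφ']
  have hs2 : Real.sin θ ^ 2 = 1 - Real.cos θ ^ 2 := by linarith
  rw [hs2]
  generalize Real.cos θ = c at *
  generalize S.sFun r = s at *
  have hce : S.chi = 1 + S.lam * S.a ^ 2 := rfl
  rw [hce] at hc ⊢
  generalize S.deltaR r = D at *
  generalize S.lam = l at *
  generalize S.a = a at *
  have := hc.ne'
  have := hT.ne'
  have := hR.ne'
  clear hce hrad hcos hsin hdr hdphi hin hsc hsp hs2
  field_simp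
  ring

/-! ### Time orientation -/

/-- The vector field `(r² + a²) ∂_t + a ∂_φ`. -/
def principal (x : Coord) : Coord := (x.rad ^ 2 + S.a ^ 2) • Coord.ddt + S.a • x.ddphi

/-- The Boyer–Lindquist coordinate vector field `∂_r` (on the blocks, where `Δ_r ≠ 0`). -/
def ddrBL (x : Coord) : Coord :=
  x.ddr + (S.sFun x.rad * S.chi / S.deltaR x.rad) • S.principal x

/-- `-∇t`, for the Boyer–Lindquist time function `t` (on `M_I`). -/
def negGradT (x : Coord) : Coord :=
  (S.chi ^ 2 * S.sigmaSq x / (S.rhoSq x * S.deltaTheta x * S.deltaR x.rad)) •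
    (Coord.ddt + (S.a * S.mu x / S.sigmaSq x) • x.ddphi)

/-- A timelike vector at the points of the horizons `r = r_+` and `r = r_c` (where `s² = 1`), the
sign being fixed by continuity from the neighbouring blocks. -/
def horizonTime (x : Coord) : Coord :=
  (1 - S.chi * S.wFun x.rad) • S.principal x - S.sFun x.rad • x.ddr

/-- The time orientation: `-∂_r` on `M_II`, `-∇t` on `M_I`, `∂_r` on `M_III`, extended to the horizons
by continuity. -/
def timeOrientation (x : Coord) : Coord :=
  if x.rad < S.rPlus then -S.ddrBL x
  else if x.rad = S.rPlus then S.horizonTime x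
  else if S.lam = 0 then S.negGradT x
  else if x.rad < S.rC then S.negGradT x
  else if x.rad = S.rC then S.horizonTime x
  else S.ddrBL x

/-- `k` is the covector `g_x(u, ·)`. -/
def IsFlat (x u : Coord) (k : Coord →L[ℝ] ℝ) : Prop := ∀ v : Coord, k v = S.metric x u v

/-- `(x, k) ∈ 𝒩⁺`: `k` is a future-directed null covector at the point `x` of the spacetime. A covector
is future-directed if it is positive on the future direction. -/
def FutureNull (x : Coord) (k : Coord →L[ℝ] ℝ) : Prop :=
  x ∈ S.spacetime ∧ (∃ u : Coord, S.IsFlat x u k ∧ S.metric x u u = 0) ∧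
    0 < k (S.timeOrientation x)

/-! ### Horizon generators -/

/-- The Killing field `v_+ = ∂_t + a / (r_+² + a²) ∂_φ`. -/
def vPlus (x : Coord) : Coord := Coord.ddt + (S.a / (S.rPlus ^ 2 + S.a ^ 2)) • x.ddphi

/-- The Killing field `v_c = ∂_t + a / (r_c² + a²) ∂_φ`, which is `∂_t` if `lam = 0` (`r_c = ∞`). -/
def vC (x : Coord) : Coord :=
  Coord.ddt + (if S.lam = 0 then 0 else S.a / (S.rC ^ 2 + S.a ^ 2)) • x.ddphi

/-! ### Null geodesics and the trapped set -/

/-- `γ`, with velocity `u`, is an affinely parametrized null geodesic of the spacetime on the open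
interval `J`. The last condition is the geodesic equation `∇_u u = 0` with its index lowered,
`d/dτ (g_{αβ} u^β) = (1/2) ∂_α g_{βν} u^β u^ν`. -/
structure IsNullGeodesic (γ u : ℝ → Coord) (J : Set ℝ) : Prop where
  isOpen : IsOpen J
  ordConnected : J.OrdConnected
  mem_spacetime : ∀ τ ∈ J, γ τ ∈ S.spacetime
  hasDerivAt : ∀ τ ∈ J, HasDerivAt γ (u τ) τ
  velocity_ne_zero : ∀ τ ∈ J, u τ ≠ 0
  null : ∀ τ ∈ J, S.metric (γ τ) (u τ) (u τ) = 0
  geodesic : ∀ τ ∈ J, ∀ v : Coord,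
    HasDerivAt (fun τ' => S.metric (γ τ') (u τ') v)
      (fderiv ℝ (fun x => S.metric x (u τ) (u τ)) (γ τ) v / 2) τ

/-- The null geodesic through `x` with cotangent `k` lies in `Γ⁺`: it exists up to `τ = +∞`, and
`r_+ < r₀ < r < R₀ < r_c` along it for all sufficiently large `τ`. -/
def GammaPlus (x : Coord) (k : Coord →L[ℝ] ℝ) : Prop :=
  ∃ (γ u : ℝ → Coord) (J : Set ℝ), S.IsNullGeodesic γ u J ∧
    (∃ τ₀ ∈ J, γ τ₀ = x ∧ S.IsFlat x (u τ₀) k) ∧ ¬ BddAbove J ∧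
    ∃ r₀ R₀ T : ℝ, S.InExterior r₀ ∧ S.InExterior R₀ ∧
      ∀ τ ∈ J, T < τ → r₀ < (γ τ).rad ∧ (γ τ).rad < R₀

/-- The null geodesic through `x` with cotangent `k` lies in `Γ⁻`: it exists down to `τ = -∞`, and
`r_+ < r₀ < r < R₀ < r_c` along it for all sufficiently small `τ`. -/
def GammaMinus (x : Coord) (k : Coord →L[ℝ] ℝ) : Prop :=
  ∃ (γ u : ℝ → Coord) (J : Set ℝ), S.IsNullGeodesic γ u J ∧
    (∃ τ₀ ∈ J, γ τ₀ = x ∧ S.IsFlat x (u τ₀) k) ∧ ¬ BddBelow J ∧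
    ∃ r₀ R₀ T : ℝ, S.InExterior r₀ ∧ S.InExterior R₀ ∧
      ∀ τ ∈ J, τ < T → r₀ < (γ τ).rad ∧ (γ τ).rad < R₀

end

end KerrDeSitter

/-! ### Roots and sign of `Δ_r`. -/

namespace KerrDeSitter

variable (S : KerrDeSitter)

/-! Put `e = k(∂_t)` and `l = k(∂_φ)`, which are constant along the geodesic, and `P(r) = (r² + a²)
e + a l`, the value of `k` on the field `principal`. This field is timelike in the exterior, and a
nonzero null covector does not vanish on a timelike vector; so `P ≠ 0` there, and the sign of `P`
decides whether `k` points to the future or to the past. Up to positive factors, the assumption on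
`k` says that `P(r_+) ≥ 0` or `P(r_c) ≥ 0` (for `λ = 0` the latter becomes `e ≥ 0`).

Suppose `P < 0` on the whole trapped end. The shape of `Δ_r` then makes `P² / Δ_r` strictly monotone
in `r`, in a fixed direction, at all radii visited (`InExterior.mul_pos_of_rPlus`,
`InExterior.mul_pos_of_rC`, `InExterior.mul_pos_of_lam_eq_zero`). The rescaled radial momentum `ψ =
ρ² r' / √Δ_r` has derivative `(χ² √Δ_r / (2 ρ²)) ∂_r (P² / Δ_r)`
(`IsNullGeodesic.hasDerivAt_radialMomentum`). By compactness `ψ'` is bounded away from `0`, although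
`ψ² ≤ χ² P² / Δ_r` is bounded: impossible over an infinite affine time. Hence `P > 0` somewhere on
the end (`IsNullGeodesic.exists_principal_pos`). Only the infinite length of the end matters, so
`Γ⁺` and `Γ⁻` are treated alike.

A continuous timelike field defined on the whole spacetime carries this sign to the base point: `k`
cannot vanish on it, so `timeComponent` keeps its sign along the geodesic.
`metric_timeOrientation_pos` compares that field with the prescribed time orientation on each block
and horizon.

The bound on the threshold is elementary: the two conditions on `r_m` are equivalent to `λ r_m³ = 1`
and `r_m³ = 3 r_m² + a²`. Since `a² ≤ 36/25` for `λ > 0`, they force `r_m ≤ 4`, hence `λ ≥ 1/64`. -/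

theorem chi_pos : 0 < S.chi := by
  have := S.lam_nonneg
  unfold chi; positivity

theorem one_le_chi : 1 ≤ S.chi := by
  have := mul_nonneg S.lam_nonneg (sq_nonneg S.a)
  unfold chi; linarith

theorem lam_eq_zero_or_pos : S.lam = 0 ∨ 0 < S.lam :=
  S.lam_nonneg.eq_or_lt.imp_left Eq.symm

theorem deltaR_rMinus : S.deltaR S.rMinus = 0 := by
  rcases S.lam_eq_zero_or_pos with h | h
  · have : S.rMinus ∈ ({S.rMinus, S.rPlus} : Set ℝ) := by simp
    rw [← S.roots_kerr h] at this; exact this.2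
  · have : S.rMinus ∈ ({S.rMinus, S.rPlus, S.rC} : Set ℝ) := by simp
    rw [← S.roots_deSitter h] at this; exact this.2

theorem deltaR_rPlus : S.deltaR S.rPlus = 0 := by
  rcases S.lam_eq_zero_or_pos with h | h
  · have : S.rPlus ∈ ({S.rMinus, S.rPlus} : Set ℝ) := by simp
    rw [← S.roots_kerr h] at this; exact this.2
  · have : S.rPlus ∈ ({S.rMinus, S.rPlus, S.rC} : Set ℝ) := by simp
    rw [← S.roots_deSitter h] at this; exact this.2

theorem deltaR_rC (h : 0 < S.lam) : S.deltaR S.rC = 0 := by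
  have : S.rC ∈ ({S.rMinus, S.rPlus, S.rC} : Set ℝ) := by simp
  rw [← S.roots_deSitter h] at this; exact this.2

theorem rMinus_add_rPlus (h : S.lam = 0) : S.rMinus + S.rPlus = 2 := by
  have e1 := S.deltaR_rMinus
  have e2 := S.deltaR_rPlus
  have := S.rMinus_lt_rPlus
  simp only [deltaR, h] at e1 e2
  have : (S.rPlus - S.rMinus) * (S.rMinus + S.rPlus - 2) = 0 := by linear_combination e2 - e1
  have := (mul_eq_zero.mp this).resolve_left (by linarith)
  linarith

theorem deltaR_eq_of_lam_eq_zero (h : S.lam = 0) (r : ℝ) :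
    S.deltaR r = (r - S.rMinus) * (r - S.rPlus) := by
  have e1 := S.deltaR_rMinus
  have e2 := S.rMinus_add_rPlus h
  simp only [deltaR, h] at e1 ⊢
  linear_combination e1 + (r - S.rMinus) * e2

/-- The divided difference of `Δ_r` at its roots `r_-` and `r_+` vanishes. -/
theorem vieta_linear :
    (1 - S.lam * S.a ^ 2) * (S.rPlus + S.rMinus)
      - S.lam * (S.rPlus ^ 2 + S.rMinus ^ 2) * (S.rPlus + S.rMinus) = 2 := by
  have e1 := S.deltaR_rMinus
  have e2 := S.deltaR_rPlus
  have := S.rMinus_lt_rPlus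
  unfold deltaR at e1 e2
  have : (S.rPlus - S.rMinus) * ((1 - S.lam * S.a ^ 2) * (S.rPlus + S.rMinus)
      - S.lam * (S.rPlus ^ 2 + S.rMinus ^ 2) * (S.rPlus + S.rMinus) - 2) = 0 := by
    linear_combination e2 - e1
  have := (mul_eq_zero.mp this).resolve_left (by linarith)
  linarith

/-- The second divided difference at the three positive roots vanishes. With `vieta_linear`, Newton
interpolation then gives the factorization of `Δ_r`; the fourth root is minus the sum of the others
because there is no cubic term. -/
theorem vieta_quadratic (h : 0 < S.lam) :
    1 - S.lam * S.a ^ 2 = S.lam * (S.rC ^ 2 + S.rPlus ^ 2 + S.rMinus ^ 2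
      + S.rC * S.rPlus + S.rC * S.rMinus + S.rPlus * S.rMinus) := by
  have e1 := S.deltaR_rMinus
  have e3 := S.deltaR_rC h
  have f1 := S.vieta_linear
  have h2 := S.rMinus_lt_rPlus
  have h3 := S.rPlus_lt_rC h
  unfold deltaR at e1 e3
  have : (S.rC - S.rMinus) * ((S.rC - S.rPlus) * (1 - S.lam * S.a ^ 2 - S.lam *
      (S.rC ^ 2 + S.rPlus ^ 2 + S.rMinus ^ 2
      + S.rC * S.rPlus + S.rC * S.rMinus + S.rPlus * S.rMinus))) = 0 := by
    linear_combination e3 - e1 - (S.rC - S.rMinus) * f1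
  have := (mul_eq_zero.mp this).resolve_left (by linarith)
  have := (mul_eq_zero.mp this).resolve_left (by linarith)
  linarith

theorem deltaR_eq_of_lam_pos (h : 0 < S.lam) (r : ℝ) :
    S.deltaR r = S.lam * (r - S.rMinus) * (r - S.rPlus) * (S.rC - r)
      * (r + S.rMinus + S.rPlus + S.rC) := by
  have e1 := S.deltaR_rMinus
  have f1 := S.vieta_linear
  have f3 := S.vieta_quadratic h
  unfold deltaR at *
  linear_combination e1 + (r - S.rMinus) * f1 + (r - S.rMinus) * (r - S.rPlus) * f3

variable {S}

theorem InExterior.rMinus_lt {r : ℝ} (h : S.InExterior r) : S.rMinus < r :=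
  S.rMinus_lt_rPlus.trans h.1

theorem InExterior.pos {r : ℝ} (h : S.InExterior r) : 0 < r :=
  S.rMinus_pos.trans h.rMinus_lt

theorem InExterior.of_le_of_le {r₀ R₀ r : ℝ} (h₀ : S.InExterior r₀) (h₁ : S.InExterior R₀)
    (hr₀ : r₀ ≤ r) (hr₁ : r ≤ R₀) : S.InExterior r :=
  ⟨h₀.1.trans_le hr₀, fun h => hr₁.trans_lt (h₁.2 h)⟩

theorem InExterior.deltaR_pos {r : ℝ} (h : S.InExterior r) : 0 < S.deltaR r := by
  have h1 := h.rMinus_lt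
  have h0 := S.rMinus_pos
  have h2 := h.1
  have h3 := S.rMinus_lt_rPlus
  rcases S.lam_eq_zero_or_pos with hl | hl
  · rw [S.deltaR_eq_of_lam_eq_zero hl]
    exact mul_pos (by linarith) (by linarith)
  · rw [S.deltaR_eq_of_lam_pos hl]
    have h4 := h.2 hl
    exact mul_pos (mul_pos (mul_pos (mul_pos hl (by linarith)) (by linarith)) (by linarith))
      (by linarith)

theorem deltaR_neg_of_lt_rPlus {r : ℝ} (h0 : S.rMinus < r) (h : r < S.rPlus) :
    S.deltaR r < 0 := by
  have h1 := S.rMinus_pos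
  rcases S.lam_eq_zero_or_pos with hl | hl
  · rw [S.deltaR_eq_of_lam_eq_zero hl]
    exact mul_neg_of_pos_of_neg (by linarith) (by linarith)
  · rw [S.deltaR_eq_of_lam_pos hl]
    have h4 := S.rPlus_lt_rC hl
    exact mul_neg_of_neg_of_pos (mul_neg_of_neg_of_pos (mul_neg_of_pos_of_neg
      (mul_pos hl (by linarith)) (by linarith)) (by linarith)) (by linarith)

theorem deltaR_neg_of_rC_lt {r : ℝ} (hl : 0 < S.lam) (h : S.rC < r) : S.deltaR r < 0 := by
  have h1 := S.rMinus_pos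
  have h3 := S.rMinus_lt_rPlus
  have h4 := S.rPlus_lt_rC hl
  rw [S.deltaR_eq_of_lam_pos hl]
  exact mul_neg_of_neg_of_pos (mul_neg_of_pos_of_neg (mul_pos
      (mul_pos hl (by linarith)) (by linarith)) (by linarith)) (by linarith)

/-! ### The derivative of `Δ_r` and the gluing functions `s` and `w`. -/

variable (S)

/-- The derivative of `Δ_r`. -/
noncomputable def deltaR' (r : ℝ) : ℝ := -4 * S.lam * r ^ 3 + 2 * (1 - S.lam * S.a ^ 2) * r - 2

theorem hasDerivAt_deltaR (r : ℝ) : HasDerivAt S.deltaR (S.deltaR' r) r := by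
  have h1 := ((hasDerivAt_pow 2 r).const_mul S.lam).const_sub 1
  have h2 := (hasDerivAt_pow 2 r).add_const (S.a ^ 2)
  have h3 := (h1.mul h2).sub ((hasDerivAt_id r).const_mul 2)
  refine h3.congr_deriv ?_
  simp [deltaR']; ring

theorem sFun_sq_sub_one {r : ℝ} (hr : S.rMinus < r) :
    S.sFun r ^ 2 - 1 = S.wFun r * S.deltaR r := by
  unfold wFun sFun
  split_ifs with h
  · simp
  · have hl : 0 < S.lam := lt_of_le_of_ne S.lam_nonneg (Ne.symm h)
    have h1 := S.rMinus_pos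
    have h2 := S.rMinus_lt_rPlus
    have h3 := S.rPlus_lt_rC hl
    rw [S.deltaR_eq_of_lam_pos hl]
    have g3 : r - S.rMinus ≠ 0 := by linarith
    have g4 : r + S.rMinus + S.rPlus + S.rC ≠ 0 := by linarith
    have g5 : S.rC - S.rPlus ≠ 0 := by linarith
    field_simp
    ring

theorem wFun_nonpos {r : ℝ} (hr : S.rMinus < r) : S.wFun r ≤ 0 := by
  unfold wFun
  split_ifs with h
  · rfl
  · have hl : 0 < S.lam := lt_of_le_of_ne S.lam_nonneg (Ne.symm h)
    have h1 := S.rMinus_pos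
    have h2 := S.rMinus_lt_rPlus
    have h3 := S.rPlus_lt_rC hl
    apply div_nonpos_of_nonpos_of_nonneg (by norm_num)
    exact mul_nonneg (mul_nonneg (mul_nonneg hl.le (by linarith)) (by linarith)) (sq_nonneg _)

theorem differentiableAt_sFun (r : ℝ) : DifferentiableAt ℝ S.sFun r := by
  unfold sFun
  by_cases h : S.lam = 0
  · simp [h]
  · simp only [h, if_false]; fun_prop

theorem differentiableAt_wFun {r : ℝ} (hr : S.rMinus < r) : DifferentiableAt ℝ S.wFun r := by
  unfold wFun
  by_cases h : S.lam = 0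
  · simp [h]
  · simp only [h, if_false]
    have hl : 0 < S.lam := lt_of_le_of_ne S.lam_nonneg (Ne.symm h)
    have h1 := S.rMinus_pos
    have h2 := S.rMinus_lt_rPlus
    have h3 := S.rPlus_lt_rC hl
    have : S.lam * (r - S.rMinus) * (r + S.rMinus + S.rPlus + S.rC) * (S.rC - S.rPlus) ^ 2 ≠ 0 :=
      (mul_pos (mul_pos (mul_pos hl (by linarith)) (by linarith))
        (pow_pos (by linarith) 2)).ne'
    fun_prop (disch := assumption)

theorem deriv_sFun_mul_sFun {r : ℝ} (hr : S.rMinus < r) :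
    2 * S.sFun r * deriv S.sFun r = deriv S.wFun r * S.deltaR r + S.wFun r * S.deltaR' r := by
  have h1 := ((S.differentiableAt_sFun r).hasDerivAt.pow 2).sub_const 1
  have h2 := (S.differentiableAt_wFun hr).hasDerivAt.mul (S.hasDerivAt_deltaR r)
  have h3 : (fun r => S.sFun r ^ 2 - 1) =ᶠ[nhds r] fun r => S.wFun r * S.deltaR r := by
    filter_upwards [lt_mem_nhds hr] with q hq using S.sFun_sq_sub_one hq
  have := h1.unique (h2.congr_of_eventuallyEq h3)
  simpa using this

/-! ### Monotonicity of `P² / Δ_r` in the exterior. -/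

variable {S}

/-- Compare logarithmic derivatives. For `λ > 0`, `Δ_r' / Δ_r = 1/A + 1/B - 1/C + 1/D`, while `4 r /
(r² - r_+²) = 2/B + 2/E`; now use `B < A` and `E < D`. For `λ = 0` the terms with `C` and `D` are
absent. Equivalently, `(r² - r_+²)² / Δ_r` increases. -/
theorem InExterior.sq_sub_rPlus_sq_mul_deltaR'_lt {r : ℝ} (h : S.InExterior r) :
    (r ^ 2 - S.rPlus ^ 2) * S.deltaR' r < 4 * r * S.deltaR r := by
  have h0 := S.rMinus_pos
  have h3 := S.rMinus_lt_rPlus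
  have h2 := h.1
  obtain ⟨A, hA⟩ : ∃ A, A = r - S.rMinus := ⟨_, rfl⟩
  obtain ⟨B, hB⟩ : ∃ B, B = r - S.rPlus := ⟨_, rfl⟩
  obtain ⟨E, hE⟩ : ∃ E, E = r + S.rPlus := ⟨_, rfl⟩
  have hA0 : 0 < A := by linarith
  have hB0 : 0 < B := by linarith
  have hE0 : 0 < E := by linarith
  have hAB : 0 < A - B := by linarith
  rcases S.lam_eq_zero_or_pos with hl | hl
  · have hd : S.deltaR' r = A + B := by
      have := S.rMinus_add_rPlus hl
      simp only [deltaR', hl]; linarith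
    rw [S.deltaR_eq_of_lam_eq_zero hl, hd, ← hA, ← hB]
    have e1 : r ^ 2 - S.rPlus ^ 2 = B * E := by rw [hB, hE]; ring
    have e2 : 4 * r = 2 * B + 2 * E := by rw [hB, hE]; ring
    have : 0 < 2 * B * (A * B) + E * B * (A - B) := by positivity
    rw [e1, e2]
    linarith
  · have h4 := h.2 hl
    obtain ⟨C, hC⟩ : ∃ C, C = S.rC - r := ⟨_, rfl⟩
    obtain ⟨D, hD⟩ : ∃ D, D = r + S.rMinus + S.rPlus + S.rC := ⟨_, rfl⟩
    have hC0 : 0 < C := by linarith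
    have hD0 : 0 < D := by linarith
    have hED : 0 < D - E := by linarith
    have hd : S.deltaR' r = S.lam * (B * C * D + A * C * D - A * B * D + A * B * C) := by
      have f1 := S.vieta_linear
      have f3 := S.vieta_quadratic hl
      simp only [deltaR', hA, hB, hC, hD]
      linear_combination f1 + (2 * r - S.rMinus - S.rPlus) * f3
    rw [S.deltaR_eq_of_lam_pos hl, hd, ← hA, ← hB, ← hC, ← hD]
    have e1 : r ^ 2 - S.rPlus ^ 2 = B * E := by rw [hB, hE]; ring
    have e2 : 4 * r = 2 * B + 2 * E := by rw [hB, hE]; ring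
    have : 0 < S.lam * (B * (A * B * C * D) + E * (A - B) * B * C * D + B * (A * B * C) * (D - E)
      + B * E * A * B * D) := by positivity
    rw [e1, e2]
    linarith

/-- The analogue at `r_c`: here `4 r / (r_c² - r²) = 2/C - 2/E`, and `A, B < E`. Equivalently,
`(r_c² - r²)² / Δ_r` decreases. -/
theorem InExterior.rC_sq_sub_sq_mul_deltaR'_lt {r : ℝ} (h : S.InExterior r) (hl : 0 < S.lam) :
    -(S.rC ^ 2 - r ^ 2) * S.deltaR' r < 4 * r * S.deltaR r := by
  have h0 := S.rMinus_pos
  have h3 := S.rMinus_lt_rPlus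
  have h2 := h.1
  obtain ⟨A, hA⟩ : ∃ A, A = r - S.rMinus := ⟨_, rfl⟩
  obtain ⟨B, hB⟩ : ∃ B, B = r - S.rPlus := ⟨_, rfl⟩
  obtain ⟨E, hE⟩ : ∃ E, E = S.rC + r := ⟨_, rfl⟩
  have h4 := h.2 hl
  obtain ⟨C, hC⟩ : ∃ C, C = S.rC - r := ⟨_, rfl⟩
  obtain ⟨D, hD⟩ : ∃ D, D = r + S.rMinus + S.rPlus + S.rC := ⟨_, rfl⟩
  have hA0 : 0 < A := by linarith
  have hB0 : 0 < B := by linarith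
  have hE0 : 0 < E := by linarith
  have hC0 : 0 < C := by linarith
  have hD0 : 0 < D := by linarith
  have hEA : 0 < E - A := by linarith
  have hEB : 0 < E - B := by linarith
  have hd : S.deltaR' r = S.lam * (B * C * D + A * C * D - A * B * D + A * B * C) := by
    have f1 := S.vieta_linear
    have f3 := S.vieta_quadratic hl
    simp only [deltaR', hA, hB, hC, hD]
    linear_combination f1 + (2 * r - S.rMinus - S.rPlus) * f3
  rw [S.deltaR_eq_of_lam_pos hl, hd, ← hA, ← hB, ← hC, ← hD]
  have e1 : S.rC ^ 2 - r ^ 2 = C * E := by rw [hC, hE]; ring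
  have e2 : 4 * r = 2 * E - 2 * C := by rw [hC, hE]; ring
  have : 0 < S.lam * (E * (A * B * C * D) + C * (E - A) * B * C * D + C * (E - B) * A * C * D
    + C * E * A * B * C) := by positivity
  rw [e1, e2]
  linarith

theorem InExterior.deltaR'_pos {r : ℝ} (h : S.InExterior r) (hl : S.lam = 0) :
    0 < S.deltaR' r := by
  have h1 := S.rMinus_add_rPlus hl
  have h2 := S.rMinus_lt_rPlus
  have h3 := h.1
  simp only [deltaR', hl]
  linarith

/-- If `P = (r² + a²) ξ_t + a ξ_φ` is nonnegative at `r_+` and negative at `r`, then `P² / Δ_r` is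
increasing at `r`. -/
theorem InExterior.mul_pos_of_rPlus {r e l : ℝ} (h : S.InExterior r)
    (hp : 0 ≤ (S.rPlus ^ 2 + S.a ^ 2) * e + S.a * l)
    (hr : (r ^ 2 + S.a ^ 2) * e + S.a * l < 0) :
    e < 0 ∧ 4 * r * e * S.deltaR r - ((r ^ 2 + S.a ^ 2) * e + S.a * l) * S.deltaR' r < 0 := by
  have h0 := S.rMinus_pos
  have h3 := S.rMinus_lt_rPlus
  have h2 := h.1
  have hq : 0 < r ^ 2 - S.rPlus ^ 2 := by nlinarith
  -- `P(r) - P(r_+) = e (r² - r_+²)`.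
  have he : e < 0 := by
    by_contra! he
    nlinarith
  refine ⟨he, ?_⟩
  have hD := h.deltaR_pos
  have hc := h.sq_sub_rPlus_sq_mul_deltaR'_lt
  have hrp := h.pos
  set P := (r ^ 2 + S.a ^ 2) * e + S.a * l with hP
  have h5 : 0 < 4 * r * S.deltaR r * (-e) := by have : 0 < -e := by linarith
                                                positivity
  -- If `Δ_r' ≥ 0`, replacing `P` by its lower bound `e (r² - r_+²)` reduces the claim to the
  -- extremal case `P(r_+) = 0`; otherwise neither term is positive and the first is negative.
  rcases le_total 0 (S.deltaR' r) with hd | hd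
  · have h6 : 0 ≤ (P - e * (r ^ 2 - S.rPlus ^ 2)) * S.deltaR' r := by
      apply mul_nonneg _ hd
      linarith
    have h7 := mul_pos_of_neg_of_neg he (sub_neg.2 hc)
    linarith
  · have := mul_nonneg_of_nonpos_of_nonpos hr.le hd
    linarith

/-- Mirror image of `InExterior.mul_pos_of_rPlus`: now `P` grows towards `r_c`, so `e > 0`, and `P²
/ Δ_r` is decreasing at `r`. -/
theorem InExterior.mul_pos_of_rC {r e l : ℝ} (h : S.InExterior r) (hl : 0 < S.lam)
    (hp : 0 ≤ (S.rC ^ 2 + S.a ^ 2) * e + S.a * l)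
    (hr : (r ^ 2 + S.a ^ 2) * e + S.a * l < 0) :
    0 < e ∧ 0 < 4 * r * e * S.deltaR r - ((r ^ 2 + S.a ^ 2) * e + S.a * l) * S.deltaR' r := by
  have hrp := h.pos
  have h2 := h.2 hl
  have hq : 0 < S.rC ^ 2 - r ^ 2 := by nlinarith
  have he : 0 < e := by
    by_contra! he
    nlinarith
  refine ⟨he, ?_⟩
  have hD := h.deltaR_pos
  have hc := h.rC_sq_sub_sq_mul_deltaR'_lt hl
  set P := (r ^ 2 + S.a ^ 2) * e + S.a * l with hP
  have h5 : 0 < 4 * r * S.deltaR r * e := by positivity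
  rcases le_total 0 (S.deltaR' r) with hd | hd
  · have := mul_nonneg (neg_nonneg.2 hr.le) hd
    linarith
  · have h6 : 0 ≤ (P + e * (S.rC ^ 2 - r ^ 2)) * (-S.deltaR' r) := by
      apply mul_nonneg _ (by linarith)
      linarith
    have h7 := mul_pos he (sub_pos.2 hc)
    linarith

theorem InExterior.mul_pos_of_lam_eq_zero {r e l : ℝ} (h : S.InExterior r) (hl : S.lam = 0)
    (hp : 0 ≤ e) (hr : (r ^ 2 + S.a ^ 2) * e + S.a * l < 0) :
    0 < 4 * r * e * S.deltaR r - ((r ^ 2 + S.a ^ 2) * e + S.a * l) * S.deltaR' r := by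
  have hrp := h.pos
  have hD := h.deltaR_pos
  have := mul_pos (neg_pos.2 hr) (h.deltaR'_pos hl)
  have h5 : 0 ≤ 4 * r * S.deltaR r * e := by positivity
  linarith

/-! ### The lower bound for `λ₀`. -/

/-- Each of the six products in `vieta_quadratic` is at least `r_-²`, so `λ r_-² ≤ 1/6`. Then
`Δ_r(r_-) = 0` gives `(5/6) (r_-² + a²) ≤ 2 r_-`. -/
theorem a_sq_le (hl : 0 < S.lam) : S.a ^ 2 ≤ 36 / 25 := by
  have h0 := S.rMinus_pos
  have h1 := S.rMinus_lt_rPlus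
  have h2 := S.rPlus_lt_rC hl
  have f3 := S.vieta_quadratic hl
  have e1 := S.deltaR_rMinus
  unfold deltaR at e1
  have h3 : 6 * S.rMinus ^ 2 ≤ S.rC ^ 2 + S.rPlus ^ 2 + S.rMinus ^ 2
      + S.rC * S.rPlus + S.rC * S.rMinus + S.rPlus * S.rMinus := by nlinarith
  have h4 := mul_le_mul_of_nonneg_left h3 hl.le
  have h5 : 0 ≤ S.lam * S.a ^ 2 := by positivity
  have h6 : S.lam * S.rMinus ^ 2 ≤ 1 / 6 := by linarith
  have h7 := mul_le_mul_of_nonneg_right h6 (by positivity : 0 ≤ S.rMinus ^ 2 + S.a ^ 2)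
  -- The bound `a² ≤ (12/5) r_- - r_-²` is largest at `r_- = 6/5`.
  nlinarith [sq_nonneg (S.rMinus - 6 / 5)]

theorem le_lam_of_deltaR_eq {rm : ℝ} (h : S.InExterior rm) (h1 : S.deltaR rm = S.a ^ 2)
    (h2 : deriv S.deltaR rm = 0) : 1 / 64 ≤ S.lam := by
  rw [(S.hasDerivAt_deltaR rm).deriv] at h2
  have hr := h.pos
  rcases S.lam_eq_zero_or_pos with hl | hl
  · exact absurd h2 (h.deltaR'_pos hl).ne'
  · have ha := S.a_sq_le hl
    unfold deltaR at h1
    unfold deltaR' at h2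
    have e1 : -S.lam * rm ^ 3 + (1 - S.lam * S.a ^ 2) * rm - 2 = 0 := by
      have : rm * (-S.lam * rm ^ 3 + (1 - S.lam * S.a ^ 2) * rm - 2) = 0 := by
        linear_combination h1
      exact (mul_eq_zero.mp this).resolve_left hr.ne'
    have e2 : S.lam * rm ^ 3 = 1 := by linear_combination e1 - h2 / 2
    have e3 : rm ^ 3 = 3 * rm ^ 2 + S.a ^ 2 := by
      linear_combination rm ^ 2 * e1 + (rm ^ 2 + S.a ^ 2) * e2
    have h4 : rm ≤ 4 := by
      by_contra! h4
      nlinarith [mul_pos (sub_pos.2 h4) (pow_pos hr 2)]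
    have h5 : rm ^ 3 ≤ 64 := by nlinarith [pow_pos hr 2]
    nlinarith [mul_le_mul_of_nonneg_left h5 hl.le]

theorem le_lambda0 (a : ℝ) : ((1 / 64 : ℝ) : EReal) ≤ lambda0 a := by
  refine le_sInf ?_
  rintro L ⟨S, rfl, rfl, rm, h, h1, h2⟩
  exact EReal.coe_le_coe_iff.2 (le_lam_of_deltaR_eq h h1 h2)

end KerrDeSitter

/-! ### Euclidean identities for `dr`, `sin² θ dφ*` and the coordinate fields. -/

namespace Coord

theorem rad_sq (x : Coord) : x.rad ^ 2 = (x.2 0) ^ 2 + (x.2 1) ^ 2 + (x.2 2) ^ 2 := by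
  simp [rad, EuclideanSpace.norm_sq_eq, Fin.sum_univ_three]

theorem inner_eq (v w : EuclideanSpace ℝ (Fin 3)) :
    inner ℝ v w = v 0 * w 0 + v 1 * w 1 + v 2 * w 2 := by
  simp [PiLp.inner_apply, Fin.sum_univ_three, mul_comm]

theorem cosSq_eq {x : Coord} (hx : 0 < x.rad) : x.cosSq = 1 - x.sinSq := by
  have := x.rad_sq
  simp only [cosSq, sinSq]
  field_simp
  linarith

theorem cosSq_nonneg (x : Coord) : 0 ≤ x.cosSq := by unfold cosSq; positivity

theorem sinSq_nonneg (x : Coord) : 0 ≤ x.sinSq := by unfold sinSq; positivity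

/-- Since `(|dy|² - dr²) / r² = dθ² + sin² θ dφ*²`, the two sides differ by `sin² θ dθ²`; the
Cartesian form also covers the axis. -/
theorem dphi_sq_le (x u : Coord) (hx : 0 < x.rad) :
    x.dphi u ^ 2 ≤ x.sinSq * ((inner ℝ u.2 u.2 - x.dr u ^ 2) / x.rad ^ 2) := by
  have hr := x.rad_sq
  have key : x.rad ^ 2 * (x.2 0 * u.2 1 - x.2 1 * u.2 0) ^ 2
      ≤ ((x.2 0) ^ 2 + (x.2 1) ^ 2) * (x.rad ^ 2 * inner ℝ u.2 u.2 - (inner ℝ x.2 u.2) ^ 2) := by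
    rw [hr, inner_eq, inner_eq]
    -- With `L = y × u` and `y · L = 0`, the difference of the two sides is `(y₀ L₁ - y₁ L₀)²`.
    have h := sq_nonneg (x.2 0 * (x.2 2 * u.2 0 - x.2 0 * u.2 2)
      - x.2 1 * (x.2 1 * u.2 2 - x.2 2 * u.2 1))
    linear_combination h
  have e : x.sinSq * ((inner ℝ u.2 u.2 - x.dr u ^ 2) / x.rad ^ 2) - x.dphi u ^ 2
      = (((x.2 0) ^ 2 + (x.2 1) ^ 2) * (x.rad ^ 2 * inner ℝ u.2 u.2 - (inner ℝ x.2 u.2) ^ 2)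
        - x.rad ^ 2 * (x.2 0 * u.2 1 - x.2 1 * u.2 0) ^ 2) / x.rad ^ 6 := by
    simp only [sinSq, dr, dphi]
    field_simp
  have : 0 ≤ x.sinSq * ((inner ℝ u.2 u.2 - x.dr u ^ 2) / x.rad ^ 2) - x.dphi u ^ 2 := by
    rw [e]; exact div_nonneg (by linarith) (by positivity)
  linarith

theorem dr_sq_le (x u : Coord) (hx : 0 < x.rad) : x.dr u ^ 2 ≤ inner ℝ u.2 u.2 := by
  have := real_inner_mul_inner_self_le x.2 u.2
  have h : inner ℝ x.2 x.2 = x.rad ^ 2 := by simp [rad]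
  rw [h] at this
  simp only [dr, div_pow]
  rw [div_le_iff₀ (by positivity)]
  linarith

variable (x : Coord)

theorem dr_add (u v : Coord) : x.dr (u + v) = x.dr u + x.dr v := by
  simp [dr, inner_add_right, add_div]

theorem dr_smul (c : ℝ) (u : Coord) : x.dr (c • u) = c * x.dr u := by
  simp [dr, inner_smul_right, mul_div_assoc]

theorem dphi_add (u v : Coord) : x.dphi (u + v) = x.dphi u + x.dphi v := by
  simp [dphi]; ring

theorem dphi_smul (c : ℝ) (u : Coord) : x.dphi (c • u) = c * x.dphi u := by
  simp [dphi]; ring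

theorem dr_ddt : x.dr ddt = 0 := by simp [dr, ddt]

theorem dphi_ddt : x.dphi ddt = 0 := by simp [dphi, ddt]

theorem dr_ddphi : x.dr x.ddphi = 0 := by
  simp [dr, ddphi, inner_eq]; ring_nf; simp

theorem dphi_ddphi : x.dphi x.ddphi = x.sinSq := by
  simp [dphi, ddphi, sinSq]; ring

theorem inner_ddphi (u : Coord) : inner ℝ u.2 x.ddphi.2 = x.rad ^ 2 * x.dphi u := by
  by_cases hx : x.rad = 0
  · have : x.2 = 0 := by simpa [rad] using hx
    simp [hx, ddphi, inner_eq, this]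
  · simp [ddphi, inner_eq, dphi]; field_simp; ring

variable {x}

theorem dr_ddr (hx : 0 < x.rad) : x.dr x.ddr = 1 := by
  simp [dr, ddr, inner_smul_right]
  field_simp
  rfl

theorem dphi_ddr : x.dphi x.ddr = 0 := by
  simp [dphi, ddr]; ring_nf; simp

theorem inner_ddr (u : Coord) : inner ℝ u.2 x.ddr.2 = x.dr u := by
  simp [dr, ddr, inner_smul_right, real_inner_comm]
  rw [div_eq_inv_mul]

end Coord

/-! ### Components of `g(u, ·)` and the radial equation for null vectors. -/

namespace KerrDeSitter

variable (S : KerrDeSitter)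

theorem tauForm_add (x u v : Coord) : S.tauForm x (u + v) = S.tauForm x u + S.tauForm x v := by
  simp [tauForm, Coord.dphi_add]; ring

theorem tauForm_smul (c : ℝ) (x u : Coord) : S.tauForm x (c • u) = c * S.tauForm x u := by
  simp [tauForm, Coord.dphi_smul]; ring

theorem metric_comm (x u v : Coord) : S.metric x u v = S.metric x v u := by
  simp only [metric, real_inner_comm]; ring

theorem metric_add_right (x u v w : Coord) :
    S.metric x u (v + w) = S.metric x u v + S.metric x u w := by
  simp only [metric, tauForm_add, Coord.dr_add, Coord.dphi_add, inner_add_right, Prod.fst_add,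
    Prod.snd_add]
  ring

theorem metric_smul_right (x u v : Coord) (c : ℝ) :
    S.metric x u (c • v) = c * S.metric x u v := by
  simp only [metric, tauForm_smul, Coord.dr_smul, Coord.dphi_smul, inner_smul_right, Prod.smul_fst,
    Prod.smul_snd, smul_eq_mul]
  ring

/-- The covector `g_x(u, ·)`. -/
noncomputable def flat (x u : Coord) : Coord →ₗ[ℝ] ℝ where
  toFun := S.metric x u
  map_add' := S.metric_add_right x u
  map_smul' c v := S.metric_smul_right x u v c

theorem metric_neg_right (x u v : Coord) : S.metric x u (-v) = -S.metric x u v :=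
  map_neg (S.flat x u) v

theorem metric_sub_right (x u v w : Coord) :
    S.metric x u (v - w) = S.metric x u v - S.metric x u w :=
  map_sub (S.flat x u) v w

variable {S} {x : Coord}

theorem rad_pos (hx : x ∈ S.spacetime) : 0 < x.rad := S.rMinus_pos.trans hx

theorem rhoSq_pos (hx : 0 < x.rad) : 0 < S.rhoSq x := by
  have := mul_nonneg (sq_nonneg S.a) x.cosSq_nonneg
  unfold rhoSq; positivity

theorem deltaTheta_pos (x : Coord) : 0 < S.deltaTheta x := by
  have := mul_nonneg (mul_nonneg S.lam_nonneg (sq_nonneg S.a)) x.cosSq_nonneg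
  unfold deltaTheta; positivity

theorem deltaTheta_mul_sub (hx : 0 < x.rad) :
    S.deltaTheta x * (x.rad ^ 2 + S.a ^ 2) - S.chi * S.rhoSq x
      = S.a ^ 2 * x.sinSq * (1 - S.lam * x.rad ^ 2) := by
  simp only [deltaTheta, chi, rhoSq, Coord.cosSq_eq hx]; ring

theorem metric_ddphi (hx : 0 < x.rad) (u : Coord) :
    S.metric x u x.ddphi = S.a * x.sinSq * (S.deltaR x.rad / (S.chi ^ 2 * S.rhoSq x)
        * S.tauForm x u - S.sFun x.rad / S.chi * x.dr u)
      - S.deltaTheta x / (S.chi ^ 2 * S.rhoSq x) * (x.rad ^ 2 + S.a ^ 2)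
        * (S.a * x.sinSq * u.1 - (x.rad ^ 2 + S.a ^ 2) * x.dphi u) := by
  have h := deltaTheta_mul_sub (S := S) hx
  have h1 := rhoSq_pos (S := S) hx
  have h2 := deltaTheta_pos (S := S) x
  have h3 := S.chi_pos
  have hτ : S.tauForm x x.ddphi = -(S.a * x.sinSq) := by
    simp [tauForm, Coord.dphi_ddphi]; simp [Coord.ddphi]
  have h0 : x.ddphi.1 = 0 := rfl
  simp only [metric, hτ, h0, Coord.dr_ddphi, Coord.dphi_ddphi, Coord.inner_ddphi]
  set R := S.rhoSq x
  set D := S.deltaTheta x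
  have e1 : S.a ^ 2 * (1 - S.lam * x.rad ^ 2)
      * (D * (x.rad ^ 2 + S.a ^ 2) + S.chi * R)
      / (S.chi ^ 2 * R * D) * (x.dphi u * x.sinSq)
      + R / (D * x.rad ^ 2) * (x.rad ^ 2 * x.dphi u) =
      D / (S.chi ^ 2 * R) * (x.rad ^ 2 + S.a ^ 2) ^ 2 * x.dphi u := by
    field_simp
    linear_combination -(x.dphi u) * (D * (x.rad ^ 2 + S.a ^ 2) + S.chi * R) * h
  linear_combination e1

theorem metric_ddt (u : Coord) :
    S.metric x u Coord.ddt = -(S.deltaR x.rad / (S.chi ^ 2 * S.rhoSq x)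
        * S.tauForm x u - S.sFun x.rad / S.chi * x.dr u)
      + S.deltaTheta x / (S.chi ^ 2 * S.rhoSq x) * S.a
        * (S.a * x.sinSq * u.1 - (x.rad ^ 2 + S.a ^ 2) * x.dphi u) := by
  have hτ : S.tauForm x Coord.ddt = 1 := by
    simp [tauForm, Coord.dphi_ddt]; simp [Coord.ddt]
  have h0 : Coord.ddt.1 = 1 := rfl
  have h1 : Coord.ddt.2 = 0 := rfl
  simp only [metric, hτ, h0, h1, Coord.dr_ddt, Coord.dphi_ddt, inner_zero_right]
  ring

theorem metric_ddr (hx : 0 < x.rad) (u : Coord) :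
    S.metric x u x.ddr = S.sFun x.rad / S.chi * S.tauForm x u
      - S.rhoSq x * S.wFun x.rad * x.dr u := by
  have h0 : x.ddr.1 = 0 := rfl
  have hτ : S.tauForm x x.ddr = 0 := by
    simp [tauForm, Coord.dphi_ddr, h0]
  simp only [metric, hτ, h0, Coord.dr_ddr hx, Coord.dphi_ddr, Coord.inner_ddr]
  ring

theorem metric_principal_eq (u : Coord) : S.metric x u (S.principal x)
    = (x.rad ^ 2 + S.a ^ 2) * S.metric x u Coord.ddt + S.a * S.metric x u x.ddphi := by
  rw [principal, metric_add_right, metric_smul_right, metric_smul_right]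

/-- The form `a dt* - (r² + a²) dφ*` annihilates `principal`, so only the terms in `τ` and `dr`
survive. -/
theorem metric_principal (hx : 0 < x.rad) (u : Coord) :
    S.metric x u (S.principal x) = -S.deltaR x.rad / S.chi ^ 2 * S.tauForm x u
      + S.sFun x.rad / S.chi * (S.rhoSq x * x.dr u) := by
  have h1 := rhoSq_pos (S := S) hx
  have h3 := S.chi_pos
  rw [metric_principal_eq, metric_ddphi hx, metric_ddt]
  have : S.rhoSq x = x.rad ^ 2 + S.a ^ 2 - S.a ^ 2 * x.sinSq := by
    rw [rhoSq, Coord.cosSq_eq hx]; ring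
  field_simp
  linear_combination (-S.deltaR x.rad * S.tauForm x u + S.sFun x.rad * S.chi * S.rhoSq x * x.dr u)
    * -this

variable (S) in
/-- The angular part of `ρ² g(u, u)`. -/
noncomputable def angular (x u : Coord) : ℝ :=
  S.deltaTheta x / S.chi ^ 2 *
      (S.a ^ 2 * x.sinSq * u.1 ^ 2 - 2 * S.a * (x.rad ^ 2 + S.a ^ 2) * (u.1 * x.dphi u))
  + S.a ^ 2 * (1 - S.lam * x.rad ^ 2)
      * (S.deltaTheta x * (x.rad ^ 2 + S.a ^ 2) + S.chi * S.rhoSq x)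
      / (S.chi ^ 2 * S.deltaTheta x) * x.dphi u ^ 2
  + S.rhoSq x ^ 2 / S.deltaTheta x * ((inner ℝ u.2 u.2 - x.dr u ^ 2) / x.rad ^ 2)

theorem rhoSq_mul_metric (hx : 0 < x.rad) (u : Coord) :
    S.rhoSq x * S.metric x u u = -S.deltaR x.rad / S.chi ^ 2 * S.tauForm x u ^ 2
      + 2 * S.sFun x.rad / S.chi * (S.tauForm x u * (S.rhoSq x * x.dr u))
      - S.wFun x.rad * (S.rhoSq x * x.dr u) ^ 2 + S.angular x u := by
  have h1 := rhoSq_pos (S := S) hx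
  have h2 := deltaTheta_pos (S := S) x
  have h3 := S.chi_pos
  simp only [metric, angular]
  field_simp
  ring

/-- The factor `sin² θ` lets the angular part be split into the square of `a dt* - (r² + a²) dφ*`
and the `dθ²` term without dividing by a quantity that vanishes on the axis. -/
theorem sinSq_mul_angular (hx : 0 < x.rad) (u : Coord) :
    x.sinSq * S.angular x u =
      S.deltaTheta x * (S.a * x.sinSq * u.1 - (x.rad ^ 2 + S.a ^ 2) * x.dphi u) ^ 2 / S.chi ^ 2
      + S.rhoSq x ^ 2 / S.deltaTheta x *
        (x.sinSq * ((inner ℝ u.2 u.2 - x.dr u ^ 2) / x.rad ^ 2) - x.dphi u ^ 2) := by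
  have h := deltaTheta_mul_sub (S := S) hx
  have h2 := deltaTheta_pos (S := S) x
  have h3 := S.chi_pos
  simp only [angular]
  generalize (inner ℝ u.2 u.2 - x.dr u ^ 2) / x.rad ^ 2 = N
  field_simp
  linear_combination -(x.dphi u) ^ 2 *
    (S.deltaTheta x * (x.rad ^ 2 + S.a ^ 2) + S.chi * S.rhoSq x) * h

theorem le_sinSq_mul_angular (hx : 0 < x.rad) (u : Coord) :
    S.deltaTheta x * (S.a * x.sinSq * u.1 - (x.rad ^ 2 + S.a ^ 2) * x.dphi u) ^ 2 / S.chi ^ 2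
      ≤ x.sinSq * S.angular x u := by
  have h2 := deltaTheta_pos (S := S) x
  have := mul_nonneg (by positivity : 0 ≤ S.rhoSq x ^ 2 / S.deltaTheta x)
    (sub_nonneg.2 (x.dphi_sq_le u hx))
  linarith [sinSq_mul_angular (S := S) hx u]

theorem dphi_eq_zero (hx : 0 < x.rad) (u : Coord) (h : x.sinSq = 0) : x.dphi u = 0 := by
  have := x.dphi_sq_le u hx
  rw [h, zero_mul] at this
  exact pow_eq_zero_iff two_ne_zero |>.1 (le_antisymm this (sq_nonneg _))

theorem angular_nonneg (hx : 0 < x.rad) (u : Coord) : 0 ≤ S.angular x u := by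
  have h2 := deltaTheta_pos (S := S) x
  -- On the axis `sinSq_mul_angular` is vacuous, but there `dphi` vanishes and `angular` is visibly
  -- nonnegative.
  rcases x.sinSq_nonneg.eq_or_lt with h | h
  · have hp := dphi_eq_zero hx u h.symm
    have := sub_nonneg.2 (x.dr_sq_le u hx)
    simp only [angular, ← h, hp]
    have : 0 ≤ S.rhoSq x ^ 2 / S.deltaTheta x * ((inner ℝ u.2 u.2 - x.dr u ^ 2) / x.rad ^ 2) := by
      positivity
    linarith
  · have h1 := le_sinSq_mul_angular (S := S) hx u
    have : 0 ≤ S.deltaTheta x * (S.a * x.sinSq * u.1 - (x.rad ^ 2 + S.a ^ 2) * x.dphi u) ^ 2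
      / S.chi ^ 2 := by positivity
    exact nonneg_of_mul_nonneg_right (this.trans h1) h

/-- Vanishing of `a dt* - (r² + a²) dφ*` and of `τ` is a linear system for `dt*` and `dφ*` with
determinant `±ρ² ≠ 0`; what remains of `angular` controls the spatial part. -/
theorem eq_zero_of_angular_eq_zero (hx : 0 < x.rad) {u : Coord} (h : S.angular x u = 0)
    (hτ : S.tauForm x u = 0) (hr : x.dr u = 0) : u = 0 := by
  have h1 := rhoSq_pos (S := S) hx
  have h2 := deltaTheta_pos (S := S) x
  have h3 := S.chi_pos
  have hb : S.a * x.sinSq * u.1 - (x.rad ^ 2 + S.a ^ 2) * x.dphi u = 0 := by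
    have := le_sinSq_mul_angular (S := S) hx u
    rw [h, mul_zero, div_le_iff₀ (by positivity), zero_mul] at this
    have := nonpos_of_mul_nonpos_right this h2
    exact pow_eq_zero_iff two_ne_zero |>.1 (le_antisymm this (sq_nonneg _))
  have hu : u.1 = S.a * x.dphi u := by unfold tauForm at hτ; linarith
  have hp : x.dphi u = 0 := by
    have hR : S.rhoSq x = x.rad ^ 2 + S.a ^ 2 - S.a ^ 2 * x.sinSq := by
      rw [rhoSq, Coord.cosSq_eq hx]; ring
    have : S.rhoSq x * x.dphi u = 0 := by
      rw [hu] at hb; rw [hR]; linarith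
    exact (mul_eq_zero.1 this).resolve_left h1.ne'
  have hu1 : u.1 = 0 := by rw [hu, hp, mul_zero]
  simp only [angular, hu1, hp, hr] at h
  have h4 : S.rhoSq x ^ 2 / S.deltaTheta x * (inner ℝ u.2 u.2 / x.rad ^ 2) = 0 := by
    simpa using h
  have h5 : inner ℝ u.2 u.2 = 0 := by
    have : S.rhoSq x ^ 2 / S.deltaTheta x ≠ 0 := by positivity
    have := (mul_eq_zero.1 h4).resolve_left this
    exact (div_eq_zero_iff.1 this).resolve_right (by positivity)
  exact Prod.ext hu1 (inner_self_eq_zero.1 h5)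

/-- Completing the square in the `principal`–`∂_r` plane. Because `s² - 1 = w Δ_r` extends through
the horizons, so does the identity; for null `u` it is Carter's radial equation. -/
theorem deltaR_mul_rhoSq_mul_metric (hx : x ∈ S.spacetime) (u : Coord) :
    S.deltaR x.rad * (S.rhoSq x * S.metric x u u) =
      (S.rhoSq x * x.dr u) ^ 2 + S.deltaR x.rad * S.angular x u
        - S.chi ^ 2 * S.metric x u (S.principal x) ^ 2 := by
  have h3 := S.chi_pos
  have hs := S.sFun_sq_sub_one hx
  rw [rhoSq_mul_metric (rad_pos hx), metric_principal (rad_pos hx)]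
  field_simp
  linear_combination (S.rhoSq x * x.dr u) ^ 2 * S.chi ^ 2 * hs

theorem chi_sq_mul_principal_sq (hx : x ∈ S.spacetime) {u : Coord} (hu : S.metric x u u = 0) :
    S.chi ^ 2 * S.metric x u (S.principal x) ^ 2 =
      (S.rhoSq x * x.dr u) ^ 2 + S.deltaR x.rad * S.angular x u := by
  have := deltaR_mul_rhoSq_mul_metric hx u
  rw [hu] at this
  linarith

theorem angular_momentum_eq (hx : 0 < x.rad) (u : Coord) :
    S.a * x.sinSq * S.metric x u Coord.ddt + S.metric x u x.ddphi
      = -S.deltaTheta x * (S.a * x.sinSq * u.1 - (x.rad ^ 2 + S.a ^ 2) * x.dphi u) / S.chi ^ 2 := by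
  have h1 := rhoSq_pos (S := S) hx
  have h3 := S.chi_pos
  rw [metric_ddphi hx, metric_ddt]
  have : S.rhoSq x = x.rad ^ 2 + S.a ^ 2 - S.a ^ 2 * x.sinSq := by
    rw [rhoSq, Coord.cosSq_eq hx]; ring
  field_simp
  linear_combination S.deltaTheta x * (S.a * x.sinSq * u.1 - (x.rad ^ 2 + S.a ^ 2) * x.dphi u)
    * this

/-- Drop the radial and the polar velocity from the radial equation. This bound serves `-∇t`, which
involves the angular momentum beyond `P`, and later keeps `P` away from `0` on compact sets. -/
theorem deltaR_mul_sq_le (hx : x ∈ S.spacetime) (hD : 0 < S.deltaR x.rad) {u : Coord}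
    (hu : S.metric x u u = 0) :
    S.deltaR x.rad * (S.a * x.sinSq * S.metric x u Coord.ddt + S.metric x u x.ddphi) ^ 2
      ≤ x.sinSq * S.deltaTheta x * S.metric x u (S.principal x) ^ 2 := by
  have h1 := chi_sq_mul_principal_sq hx hu
  have h2 := le_sinSq_mul_angular (S := S) (rad_pos hx) u
  have h3 := S.chi_pos
  have h4 := deltaTheta_pos (S := S) x
  rw [angular_momentum_eq (rad_pos hx)]
  set b := S.a * x.sinSq * u.1 - (x.rad ^ 2 + S.a ^ 2) * x.dphi u
  have h5 : S.deltaR x.rad * S.angular x u ≤ S.chi ^ 2 * S.metric x u (S.principal x) ^ 2 := by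
    rw [h1]; linarith [sq_nonneg (S.rhoSq x * x.dr u)]
  calc S.deltaR x.rad * (-S.deltaTheta x * b / S.chi ^ 2) ^ 2
      = S.deltaR x.rad * S.deltaTheta x / S.chi ^ 2 * (S.deltaTheta x * b ^ 2 / S.chi ^ 2) := by
        field_simp
    _ ≤ S.deltaR x.rad * S.deltaTheta x / S.chi ^ 2 * (x.sinSq * S.angular x u) := by gcongr
    _ = x.sinSq * S.deltaTheta x / S.chi ^ 2 * (S.deltaR x.rad * S.angular x u) := by ring
    _ ≤ x.sinSq * S.deltaTheta x / S.chi ^ 2 * (S.chi ^ 2 * S.metric x u (S.principal x) ^ 2) := by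
        have := x.sinSq_nonneg
        gcongr
    _ = _ := by field_simp

end KerrDeSitter

/-! ### Timelike vectors in the `principal`–`∂_r` plane and the time orientation. -/

namespace KerrDeSitter

variable {S : KerrDeSitter} {x : Coord}

variable (S) in
/-- `-g / ρ²` on the plane of the vectors `α • principal + β • ddr`. -/
noncomputable def planeForm (r α β α' β' : ℝ) : ℝ :=
  α * α' * (S.deltaR r / S.chi ^ 2) - (α * β' + α' * β) * (S.sFun r / S.chi) + β * β' * S.wFun r

/-- A null vector orthogonal to a timelike one is zero: the plane is Lorentzian and the
complementary part `angular` is nonnegative. -/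
theorem plane_ne_zero (hx : x ∈ S.spacetime) {u : Coord} (hu : S.metric x u u = 0) (hu0 : u ≠ 0)
    {α β : ℝ} (hQ : 0 < S.planeForm x.rad α β α β) :
    α * S.metric x u (S.principal x) + β * S.metric x u x.ddr ≠ 0 := by
  intro h
  have hr := rad_pos hx
  have h1 := rhoSq_pos (S := S) hr
  have h3 := S.chi_pos
  have hs := S.sFun_sq_sub_one hx
  have hn := rhoSq_mul_metric (S := S) hr u
  rw [hu, mul_zero] at hn
  rw [metric_principal hr, metric_ddr hr] at h
  have hΘ := angular_nonneg (S := S) hr u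
  refine hu0 ?_
  unfold planeForm at hQ
  set η := S.rhoSq x * x.dr u with hη
  set τ := S.tauForm x u
  set Θ := S.angular x u
  set Q := α * α * (S.deltaR x.rad / S.chi ^ 2) - (α * β + α * β) * (S.sFun x.rad / S.chi)
    + β * β * S.wFun x.rad with hQd
  have h' : τ * (α * (S.deltaR x.rad / S.chi ^ 2) - β * (S.sFun x.rad / S.chi))
      + η * (β * S.wFun x.rad - α * (S.sFun x.rad / S.chi)) = 0 := by
    linear_combination -h
  -- The plane form has determinant `-1/χ²`, so orthogonality and nullity combine into a vanishing
  -- sum of two nonnegative terms.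
  have key : Θ * Q + (τ * β - η * α) ^ 2 / S.chi ^ 2 = 0 := by
    have : Θ = S.deltaR x.rad / S.chi ^ 2 * τ ^ 2
      - 2 * S.sFun x.rad / S.chi * (τ * η) + S.wFun x.rad * η ^ 2 := by linear_combination -hn
    have e : (τ * (α * (S.deltaR x.rad / S.chi ^ 2) - β * (S.sFun x.rad / S.chi))
      + η * (β * S.wFun x.rad - α * (S.sFun x.rad / S.chi))) ^ 2 = 0 := by rw [h']; ring
    rw [this, hQd]
    field_simp at e ⊢
    linear_combination e - (τ * β - η * α) ^ 2 * S.chi ^ 2 * hs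
  have k1 : 0 ≤ Θ * Q := mul_nonneg hΘ hQ.le
  have k2 : 0 ≤ (τ * β - η * α) ^ 2 / S.chi ^ 2 := by positivity
  have hΘ0 : Θ = 0 := (mul_eq_zero.1 (by linarith : Θ * Q = 0)).resolve_right hQ.ne'
  have hw : τ * β - η * α = 0 := by
    have : (τ * β - η * α) ^ 2 / S.chi ^ 2 = 0 := by linarith
    have := (div_eq_zero_iff.1 this).resolve_right (by positivity)
    exact pow_eq_zero_iff two_ne_zero |>.1 this
  have hτ : τ = 0 := by
    have : τ * Q = 0 := by
      rw [hQd]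
      linear_combination α * h' + (β * S.wFun x.rad - α * (S.sFun x.rad / S.chi)) * hw
    exact (mul_eq_zero.1 this).resolve_right hQ.ne'
  have hη0 : η = 0 := by
    have : η * Q = 0 := by
      rw [hQd]
      linear_combination β * h' - (α * (S.deltaR x.rad / S.chi ^ 2)
        - β * (S.sFun x.rad / S.chi)) * hw
    exact (mul_eq_zero.1 this).resolve_right hQ.ne'
  exact eq_zero_of_angular_eq_zero hr hΘ0 hτ ((mul_eq_zero.1 hη0).resolve_left h1.ne')

/-- If the two signs disagreed, a combination of the two vectors with nonnegative coefficients would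
be annihilated. It is still timelike, as the two lie in the same cone, contradicting
`plane_ne_zero`. -/
theorem plane_pos_of_plane_pos (hx : x ∈ S.spacetime) {u : Coord} (hu : S.metric x u u = 0)
    (hu0 : u ≠ 0) {α β α' β' : ℝ} (hQ : 0 < S.planeForm x.rad α β α β)
    (hQ' : 0 < S.planeForm x.rad α' β' α' β') (hQQ : 0 < S.planeForm x.rad α β α' β')
    (h : 0 < α * S.metric x u (S.principal x) + β * S.metric x u x.ddr) :
    0 < α' * S.metric x u (S.principal x) + β' * S.metric x u x.ddr := by
  by_contra! h'
  set A := S.metric x u (S.principal x)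
  set B := S.metric x u x.ddr
  set s := α * A + β * B with hs
  set t := -(α' * A + β' * B) with ht
  have ht0 : 0 ≤ t := by linarith
  refine plane_ne_zero hx hu hu0 (α := t * α + s * α') (β := t * β + s * β') ?_ ?_
  · have : S.planeForm x.rad (t * α + s * α') (t * β + s * β') (t * α + s * α') (t * β + s * β')
      = t ^ 2 * S.planeForm x.rad α β α β + 2 * t * s * S.planeForm x.rad α β α' β'
        + s ^ 2 * S.planeForm x.rad α' β' α' β' := by
      unfold planeForm; ring
    rw [this]
    positivity
  · change (t * α + s * α') * A + (t * β + s * β') * B = 0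
    linear_combination -t * hs - s * ht

variable (S) in
/-- The coefficient of `principal` in the globally defined timelike vector field
`timeCoeff • principal - s • ddr`. -/
noncomputable def timeCoeff (r : ℝ) : ℝ := 1 / (1 + S.deltaR r ^ 2) - S.chi * S.wFun r

variable (S) in
/-- The value of `k = g_x(u, ·)` on a globally defined continuous timelike vector field. -/
noncomputable def timeComponent (x u : Coord) : ℝ :=
  S.timeCoeff x.rad * S.metric x u (S.principal x) + -S.sFun x.rad * S.metric x u x.ddr

/-- With `z = 1 / (1 + Δ_r²)`, the form equals `z (z Δ_r + 2 χ) / χ² - w`. The damping in `z`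
ensures `z Δ_r ≥ -1` where `Δ_r` is very negative, while `χ ≥ 1` and `w ≤ 0`. -/
theorem planeForm_timeCoeff (hx : x ∈ S.spacetime) :
    0 < S.planeForm x.rad (S.timeCoeff x.rad) (-S.sFun x.rad)
      (S.timeCoeff x.rad) (-S.sFun x.rad) := by
  have hs := S.sFun_sq_sub_one hx
  have hw := S.wFun_nonpos hx
  have h3 := S.chi_pos
  have h4 := S.one_le_chi
  unfold planeForm timeCoeff
  set D := S.deltaR x.rad
  set w := S.wFun x.rad
  set s := S.sFun x.rad
  set z := 1 / (1 + D ^ 2) with hz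
  have hz0 : 0 < z := by positivity
  have hzD : -1 ≤ z * D := by
    rw [hz, one_div, inv_mul_eq_div, le_div_iff₀ (by positivity)]
    nlinarith
  have e : (z - S.chi * w) * (z - S.chi * w) * (D / S.chi ^ 2)
      - ((z - S.chi * w) * -s + (z - S.chi * w) * -s) * (s / S.chi) + -s * -s * w
      = z * (z * D + 2 * S.chi) / S.chi ^ 2 - w := by
    field_simp
    linear_combination S.chi * (2 * z - S.chi * w) * hs
  rw [e]
  have : 0 < z * (z * D + 2 * S.chi) / S.chi ^ 2 := by
    have : 0 < z * D + 2 * S.chi := by linarith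
    positivity
  linarith

theorem timeComponent_ne_zero (hx : x ∈ S.spacetime) {u : Coord} (hu : S.metric x u u = 0)
    (hu0 : u ≠ 0) : S.timeComponent x u ≠ 0 :=
  plane_ne_zero hx hu hu0 (planeForm_timeCoeff hx)

theorem principal_timelike (hx : S.InExterior x.rad) : 0 < S.planeForm x.rad 1 0 1 0 := by
  have := hx.deltaR_pos
  have h3 := S.chi_pos
  simp only [planeForm, one_mul, mul_zero, zero_mul, add_zero, sub_zero]
  positivity

theorem planeForm_timeCoeff_principal (hx : S.InExterior x.rad) :
    0 < S.planeForm x.rad (S.timeCoeff x.rad) (-S.sFun x.rad) 1 0 := by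
  have hD := hx.deltaR_pos
  have h3 := S.chi_pos
  have hs := S.sFun_sq_sub_one hx.rMinus_lt
  have e : S.planeForm x.rad (S.timeCoeff x.rad) (-S.sFun x.rad) 1 0 =
      1 / (1 + S.deltaR x.rad ^ 2) * (S.deltaR x.rad / S.chi ^ 2) + 1 / S.chi := by
    unfold planeForm timeCoeff
    generalize 1 / (1 + S.deltaR x.rad ^ 2) = z
    field_simp
    linear_combination S.chi * hs
  rw [e]
  positivity

theorem planeForm_comm (r α β α' β' : ℝ) :
    S.planeForm r α β α' β' = S.planeForm r α' β' α β := by unfold planeForm; ring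

theorem timeComponent_pos_of_principal_pos (hx : S.InExterior x.rad) {u : Coord}
    (hu : S.metric x u u = 0) (hu0 : u ≠ 0) (h : 0 < S.metric x u (S.principal x)) :
    0 < S.timeComponent x u := by
  refine plane_pos_of_plane_pos hx.rMinus_lt hu hu0 (α := 1) (β := 0) (principal_timelike hx)
    (planeForm_timeCoeff hx.rMinus_lt) ?_ (by simpa using h)
  rw [planeForm_comm]; exact planeForm_timeCoeff_principal hx

theorem principal_pos_of_timeComponent_pos (hx : S.InExterior x.rad) {u : Coord}
    (hu : S.metric x u u = 0) (hu0 : u ≠ 0) (h : 0 < S.timeComponent x u) :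
    0 < S.metric x u (S.principal x) := by
  simpa using plane_pos_of_plane_pos hx.rMinus_lt hu hu0 (planeForm_timeCoeff hx.rMinus_lt)
    (principal_timelike hx) (planeForm_timeCoeff_principal hx) h

theorem principal_ne_zero (hx : S.InExterior x.rad) {u : Coord} (hu : S.metric x u u = 0)
    (hu0 : u ≠ 0) : S.metric x u (S.principal x) ≠ 0 := by
  simpa using plane_ne_zero hx.rMinus_lt hu hu0 (principal_timelike hx)

theorem ddrBL_timelike (hx : x ∈ S.spacetime) (hD : S.deltaR x.rad < 0) :
    0 < S.planeForm x.rad (S.sFun x.rad * S.chi / S.deltaR x.rad) 1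
      (S.sFun x.rad * S.chi / S.deltaR x.rad) 1 := by
  have h3 := S.chi_pos
  have hs := S.sFun_sq_sub_one hx
  have e : S.planeForm x.rad (S.sFun x.rad * S.chi / S.deltaR x.rad) 1
      (S.sFun x.rad * S.chi / S.deltaR x.rad) 1 = -1 / S.deltaR x.rad := by
    unfold planeForm
    have := hD.ne
    field_simp
    linear_combination -hs
  rw [e]
  exact div_pos_of_neg_of_neg (by norm_num) hD

/-- The sign of `s` selects the cone: `s > 0` inside `r_+` puts the global field with `-∂_r`, and `s
< 0` beyond `r_c` puts it with `∂_r`. -/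
theorem planeForm_timeCoeff_ddrBL (hx : x ∈ S.spacetime) (hD : S.deltaR x.rad < 0) :
    S.planeForm x.rad (S.timeCoeff x.rad) (-S.sFun x.rad)
      (S.sFun x.rad * S.chi / S.deltaR x.rad) 1 = S.sFun x.rad / S.deltaR x.rad := by
  have h3 := S.chi_pos
  have hs := S.sFun_sq_sub_one hx
  unfold planeForm
  generalize S.timeCoeff x.rad = z
  have := hD.ne
  field_simp
  linear_combination S.sFun x.rad * S.chi * hs

theorem planeForm_neg (r α β : ℝ) :
    S.planeForm r (-α) (-β) (-α) (-β) = S.planeForm r α β α β := by unfold planeForm; ring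

theorem planeForm_neg_right (r α β α' β' : ℝ) :
    S.planeForm r α β (-α') (-β') = -S.planeForm r α β α' β' := by unfold planeForm; ring

theorem metric_ddrBL (u : Coord) : S.metric x u (S.ddrBL x)
    = S.sFun x.rad * S.chi / S.deltaR x.rad * S.metric x u (S.principal x)
      + 1 * S.metric x u x.ddr := by
  rw [ddrBL, metric_add_right, metric_smul_right]; ring

theorem metric_ddrBL_neg_of_lt_rPlus (hx : x ∈ S.spacetime) (h : x.rad < S.rPlus) {u : Coord}
    (hu : S.metric x u u = 0) (hu0 : u ≠ 0) (hp : 0 < S.timeComponent x u) :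
    0 < S.metric x u (-S.ddrBL x) := by
  have hD := deltaR_neg_of_lt_rPlus hx h
  have hs : 0 < S.sFun x.rad := by
    unfold sFun
    split_ifs with hl
    · norm_num
    · have := S.rPlus_lt_rC (S.lam_eq_zero_or_pos.resolve_left hl)
      exact div_pos (by linarith) (by linarith)
  have := plane_pos_of_plane_pos hx hu hu0 (planeForm_timeCoeff hx)
    (α' := -(S.sFun x.rad * S.chi / S.deltaR x.rad)) (β' := -1)
    (by rw [planeForm_neg]; exact ddrBL_timelike hx hD)
    (by
      rw [planeForm_neg_right, planeForm_timeCoeff_ddrBL hx hD, neg_pos]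
      exact div_neg_of_pos_of_neg hs hD) hp
  rw [metric_neg_right, metric_ddrBL]
  linarith

theorem metric_ddrBL_pos_of_rC_lt (hl : 0 < S.lam) (h : S.rC < x.rad) {u : Coord}
    (hu : S.metric x u u = 0) (hu0 : u ≠ 0) (hp : 0 < S.timeComponent x u) :
    0 < S.metric x u (S.ddrBL x) := by
  have h1 := S.rPlus_lt_rC hl
  have hx : x ∈ S.spacetime := (S.rMinus_lt_rPlus.trans h1).trans h
  have hD := deltaR_neg_of_rC_lt hl h
  have hs : S.sFun x.rad < 0 := by
    unfold sFun
    rw [if_neg hl.ne']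
    exact div_neg_of_neg_of_pos (by linarith) (by linarith)
  rw [metric_ddrBL]
  refine plane_pos_of_plane_pos hx hu hu0 (planeForm_timeCoeff hx) (ddrBL_timelike hx hD) ?_ hp
  rw [planeForm_timeCoeff_ddrBL hx hD]
  exact div_pos_of_neg_of_neg hs hD

/-- Where `Δ_r = 0`, the coefficient `timeCoeff` is `1 - χ w`, so the global field coincides with
`horizonTime`. -/
theorem metric_horizonTime_pos (hx : x ∈ S.spacetime) (hD : S.deltaR x.rad = 0) {u : Coord}
    (hu : S.metric x u u = 0) (hu0 : u ≠ 0) (hp : 0 < S.timeComponent x u) :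
    0 < S.metric x u (S.horizonTime x) := by
  have h3 := S.chi_pos
  have hs := S.sFun_sq_sub_one hx
  have hw := S.wFun_nonpos hx
  have e : S.metric x u (S.horizonTime x) = (1 - S.chi * S.wFun x.rad) *
      S.metric x u (S.principal x) + -S.sFun x.rad * S.metric x u x.ddr := by
    rw [horizonTime, metric_sub_right, metric_smul_right, metric_smul_right]; ring
  rw [e]
  rw [hD, mul_zero] at hs
  have e1 : ∀ α α' : ℝ, S.planeForm x.rad α (-S.sFun x.rad) α' (-S.sFun x.rad)
      = (α + α') / S.chi + S.wFun x.rad := by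
    intro α α'
    unfold planeForm
    rw [hD]
    linear_combination ((α + α') / S.chi + S.wFun x.rad) * hs
  have e2 : ∀ z : ℝ, z - S.chi * S.wFun x.rad = S.chi * (z / S.chi - S.wFun x.rad) := by
    intro z; field_simp
  refine plane_pos_of_plane_pos hx hu hu0 (planeForm_timeCoeff hx) ?_ ?_ hp
  · rw [e1]
    have : (1 - S.chi * S.wFun x.rad + (1 - S.chi * S.wFun x.rad)) / S.chi + S.wFun x.rad
      = 2 / S.chi + -S.wFun x.rad := by field_simp; ring
    rw [this]
    have : 0 < 2 / S.chi := by positivity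
    linarith
  · rw [e1]
    have : (S.timeCoeff x.rad + (1 - S.chi * S.wFun x.rad)) / S.chi + S.wFun x.rad
      = 2 / S.chi + -S.wFun x.rad := by simp only [timeCoeff, hD]; field_simp; ring
    rw [this]
    have : 0 < 2 / S.chi := by positivity
    linarith

/-- In general `-∇t` leaves the plane. The value of `k` on it is a positive multiple of `(r² + a²)
Δ_θ P - a Δ_r Z`, where `Z = a sin² θ e + l`; the first term dominates by `deltaR_mul_sq_le` and `σ²
> 0`. -/
theorem metric_negGradT_pos (hx : S.InExterior x.rad) {u : Coord} (hu : S.metric x u u = 0)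
    (hp : 0 < S.metric x u (S.principal x)) : 0 < S.metric x u (S.negGradT x) := by
  have hD := hx.deltaR_pos
  have hr := hx.pos
  have h1 := rhoSq_pos (S := S) hr
  have h2 := deltaTheta_pos (S := S) x
  have h3 := S.chi_pos
  have hS0 := x.sinSq_nonneg
  have hS1 : x.sinSq ≤ 1 := by linarith [x.cosSq_nonneg, Coord.cosSq_eq hr]
  have hle := deltaR_mul_sq_le hx.rMinus_lt hD hu
  have hDl : S.deltaR x.rad < x.rad ^ 2 + S.a ^ 2 := by
    have : 0 ≤ S.lam * (x.rad ^ 2 * (x.rad ^ 2 + S.a ^ 2)) :=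
      mul_nonneg S.lam_nonneg (by positivity)
    unfold deltaR; linarith
  have hT1 : 1 ≤ S.deltaTheta x := by
    have := mul_nonneg (mul_nonneg S.lam_nonneg (sq_nonneg S.a)) x.cosSq_nonneg
    unfold deltaTheta; linarith
  have ha : S.a ^ 2 * x.sinSq * S.deltaR x.rad < (x.rad ^ 2 + S.a ^ 2) ^ 2 * S.deltaTheta x := by
    have hA : 0 < x.rad ^ 2 + S.a ^ 2 := by positivity
    calc S.a ^ 2 * x.sinSq * S.deltaR x.rad ≤ S.a ^ 2 * 1 * S.deltaR x.rad := by gcongr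
      _ ≤ (x.rad ^ 2 + S.a ^ 2) * S.deltaR x.rad := by
        have := sq_nonneg x.rad
        gcongr; linarith
      _ < (x.rad ^ 2 + S.a ^ 2) * (x.rad ^ 2 + S.a ^ 2) := by gcongr
      _ = (x.rad ^ 2 + S.a ^ 2) ^ 2 * 1 := by ring
      _ ≤ _ := by gcongr
  have hσ : 0 < S.sigmaSq x := by unfold sigmaSq; linarith
  rw [negGradT, metric_smul_right, metric_add_right, metric_smul_right]
  refine mul_pos (by positivity) ?_
  have hPe := metric_principal_eq (S := S) (x := x) u
  have e : S.metric x u Coord.ddt + S.a * S.mu x / S.sigmaSq x * S.metric x u x.ddphi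
      = ((x.rad ^ 2 + S.a ^ 2) * S.deltaTheta x * S.metric x u (S.principal x)
        - S.a * S.deltaR x.rad *
          (S.a * x.sinSq * S.metric x u Coord.ddt + S.metric x u x.ddphi)) / S.sigmaSq x := by
    rw [hPe]
    field_simp
    unfold sigmaSq mu
    ring
  rw [e]
  refine div_pos ?_ hσ
  set Z := S.a * x.sinSq * S.metric x u Coord.ddt + S.metric x u x.ddphi
  set P := S.metric x u (S.principal x)
  refine sub_pos.2 (abs_lt_of_sq_lt_sq' ?_ (by positivity)).2
  calc (S.a * S.deltaR x.rad * Z) ^ 2 = S.a ^ 2 * S.deltaR x.rad * (S.deltaR x.rad * Z ^ 2) := by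
        ring
    _ ≤ S.a ^ 2 * S.deltaR x.rad * (x.sinSq * S.deltaTheta x * P ^ 2) := by gcongr
    _ = (S.a ^ 2 * x.sinSq * S.deltaR x.rad) * (S.deltaTheta x * P ^ 2) := by ring
    _ < ((x.rad ^ 2 + S.a ^ 2) ^ 2 * S.deltaTheta x) * (S.deltaTheta x * P ^ 2) := by gcongr
    _ = _ := by ring

theorem metric_timeOrientation_pos (hx : x ∈ S.spacetime) {u : Coord}
    (hu : S.metric x u u = 0) (hu0 : u ≠ 0) (hp : 0 < S.timeComponent x u) :
    0 < S.metric x u (S.timeOrientation x) := by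
  unfold timeOrientation
  split_ifs with h1 h2 h3 h4 h5
  · exact metric_ddrBL_neg_of_lt_rPlus hx h1 hu hu0 hp
  · exact metric_horizonTime_pos hx (by rw [h2, deltaR_rPlus]) hu hu0 hp
  · have he : S.InExterior x.rad := 
      ⟨lt_of_le_of_ne (not_lt.1 h1) (Ne.symm h2), fun h => by simp [h3] at h⟩
    exact metric_negGradT_pos he hu (principal_pos_of_timeComponent_pos he hu hu0 hp)
  · have he : S.InExterior x.rad := ⟨lt_of_le_of_ne (not_lt.1 h1) (Ne.symm h2), fun _ => h4⟩
    exact metric_negGradT_pos he hu (principal_pos_of_timeComponent_pos he hu hu0 hp)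
  · have hl := S.lam_eq_zero_or_pos.resolve_left h3
    exact metric_horizonTime_pos hx (by rw [h5, S.deltaR_rC hl]) hu hu0 hp
  · have hl := S.lam_eq_zero_or_pos.resolve_left h3
    exact metric_ddrBL_pos_of_rC_lt hl (lt_of_le_of_ne (not_lt.1 h4) (Ne.symm h5)) hu hu0 hp

end KerrDeSitter

/-! ### Differentiability, and dilations and rotations as linear vector fields. -/

namespace Coord

variable {x : Coord}

theorem differentiableAt_div {f g : Coord → ℝ} (hf : DifferentiableAt ℝ f x)
    (hg : DifferentiableAt ℝ g x) (h : g x ≠ 0) : DifferentiableAt ℝ (fun x => f x / g x) x := by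
  simp only [div_eq_mul_inv]
  exact hf.fun_mul (hg.fun_inv h)

theorem snd_ne_zero (hx : 0 < x.rad) : x.2 ≠ 0 := norm_pos_iff.1 hx

theorem differentiableAt_rad (hx : 0 < x.rad) : DifferentiableAt ℝ rad x :=
  differentiableAt_snd.norm ℝ (snd_ne_zero hx)

theorem differentiableAt_apply (x : Coord) (i : Fin 3) :
    DifferentiableAt ℝ (fun x : Coord => x.2 i) x :=
  ((EuclideanSpace.proj i).comp (ContinuousLinearMap.snd ℝ ℝ (EuclideanSpace ℝ (Fin 3))) :
    Coord →L[ℝ] ℝ).differentiableAt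

theorem differentiableAt_cosSq (hx : 0 < x.rad) : DifferentiableAt ℝ cosSq x :=
  differentiableAt_div ((differentiableAt_apply x 2).fun_pow 2)
    ((differentiableAt_rad hx).fun_pow 2) (by positivity)

theorem differentiableAt_sinSq (hx : 0 < x.rad) : DifferentiableAt ℝ sinSq x :=
  differentiableAt_div
    (((differentiableAt_apply x 0).fun_pow 2).fun_add ((differentiableAt_apply x 1).fun_pow 2))
    ((differentiableAt_rad hx).fun_pow 2) (by positivity)

theorem differentiableAt_dr (hx : 0 < x.rad) (u : Coord) :
    DifferentiableAt ℝ (fun x => dr x u) x :=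
  differentiableAt_div (differentiableAt_snd.inner ℝ (differentiableAt_const _))
    (differentiableAt_rad hx) hx.ne'

theorem differentiableAt_dphi (hx : 0 < x.rad) (u : Coord) :
    DifferentiableAt ℝ (fun x => dphi x u) x :=
  differentiableAt_div (((differentiableAt_apply x 0).mul_const _).fun_sub
    ((differentiableAt_apply x 1).mul_const _)) ((differentiableAt_rad hx).fun_pow 2)
    (by positivity)

theorem hasDerivAt_rad {γ : ℝ → Coord} {u : Coord} {τ : ℝ} (hγ : HasDerivAt γ u τ)
    (hx : 0 < (γ τ).rad) : HasDerivAt (fun τ => (γ τ).rad) ((γ τ).dr u) τ := by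
  have h : HasDerivAt (fun τ => (γ τ).2) u.2 τ := hγ.snd
  have h1 := h.norm_sq.sqrt (by have : 0 < ‖(γ τ).2‖ := hx; positivity)
  refine (h1.congr_deriv ?_).congr_of_eventuallyEq (Filter.Eventually.of_forall fun τ => ?_)
  · rw [Real.sqrt_sq (norm_nonneg _)]
    simp only [dr, rad]
    field_simp
  · simp [rad]

theorem eq_sum (v : Coord) : v = v.1 • ddt
    + ∑ i, v.2 i • ((0, EuclideanSpace.single i 1) : Coord) := by
  ext i
  · simp [ddt, Prod.fst_sum]
  · fin_cases i <;> simp [ddt, Fin.sum_univ_three]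

/-- The generator `(t, y) ↦ (0, y)` of the spatial dilations. -/
noncomputable def dilation : Coord →L[ℝ] Coord :=
  (ContinuousLinearMap.inr ℝ ℝ (EuclideanSpace ℝ (Fin 3))).comp (ContinuousLinearMap.snd ℝ ℝ _)

theorem dilation_apply (x : Coord) : dilation x = (0, x.2) := rfl

/-- The generator of the rotations about the axis. -/
noncomputable def rotation : Coord →L[ℝ] Coord :=
  LinearMap.toContinuousLinearMap
    { toFun := ddphi
      map_add' := by
        intro x y
        ext i
        · simp [ddphi]
        · fin_cases i <;> simp [ddphi]; ring
      map_smul' := by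
        intro c x
        ext i
        · simp [ddphi]
        · fin_cases i <;> simp [ddphi] }

theorem rotation_apply (x : Coord) : rotation x = x.ddphi := rfl

end Coord

/-! ### Derivatives of the metric along `∂_t`, rotations and dilations. -/

namespace KerrDeSitter

variable {S : KerrDeSitter} {x : Coord}

theorem differentiableAt_metric (hx : x ∈ S.spacetime) (u v : Coord) :
    DifferentiableAt ℝ (fun x => S.metric x u v) x := by
  have hr := rad_pos hx
  have h1 := rhoSq_pos (S := S) hr
  have h2 := deltaTheta_pos (S := S) x
  have h3 := S.chi_pos
  have dR := Coord.differentiableAt_rad hr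
  have dC := Coord.differentiableAt_cosSq hr
  have dS := Coord.differentiableAt_sinSq hr
  have dr := Coord.differentiableAt_dr hr
  have dp := Coord.differentiableAt_dphi hr
  have dD : DifferentiableAt ℝ (fun x : Coord => S.deltaR x.rad) x :=
    (S.hasDerivAt_deltaR x.rad).differentiableAt.comp x dR
  have ds : DifferentiableAt ℝ (fun x : Coord => S.sFun x.rad) x :=
    (S.differentiableAt_sFun x.rad).comp x dR
  have dw : DifferentiableAt ℝ (fun x : Coord => S.wFun x.rad) x :=
    (S.differentiableAt_wFun hx).comp x dR
  have dT : DifferentiableAt ℝ (fun x : Coord => S.deltaTheta x) x :=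
    (dC.const_mul _).const_add _
  have dρ : DifferentiableAt ℝ (fun x : Coord => S.rhoSq x) x :=
    (dR.fun_pow 2).fun_add (dC.const_mul _)
  have dτ : ∀ u, DifferentiableAt ℝ (fun x : Coord => S.tauForm x u) x := fun u =>
    ((dp u).const_mul _).const_sub _
  have n1 : S.chi ^ 2 * S.rhoSq x ≠ 0 := by positivity
  have n2 : S.chi ^ 2 * S.rhoSq x * S.deltaTheta x ≠ 0 := by positivity
  have n3 : S.deltaTheta x * x.rad ^ 2 ≠ 0 := by positivity
  have d := @Coord.differentiableAt_div x
  have t1 := (d dD (dρ.const_mul _) n1).fun_neg.fun_mul ((dτ u).fun_mul (dτ v))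
  have t2 := (ds.mul_const S.chi⁻¹).fun_mul
    (((dτ u).fun_mul (dr v)).fun_add ((dr u).fun_mul (dτ v)))
  have t3 := (dρ.fun_mul dw).fun_mul ((dr u).fun_mul (dr v))
  have t4 := (d dT (dρ.const_mul _) n1).fun_mul
    (((dS.const_mul (S.a ^ 2)).mul_const (u.1 * v.1)).fun_sub
      ((((dR.fun_pow 2).add_const (S.a ^ 2)).const_mul S.a).fun_mul
        (((dp v).const_mul u.1).fun_add ((dp u).mul_const v.1))))
  have t5 := (d (((((dR.fun_pow 2).const_mul S.lam).const_sub 1).const_mul (S.a ^ 2)).fun_mul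
      ((dT.fun_mul ((dR.fun_pow 2).add_const (S.a ^ 2))).fun_add (dρ.const_mul S.chi)))
        ((dρ.const_mul _).fun_mul dT) n2).fun_mul ((dp u).fun_mul (dp v))
  have t6 := (d dρ (dT.fun_mul (dR.fun_pow 2)) n3).fun_mul
    (((dr u).fun_mul (dr v)).const_sub (inner ℝ u.2 v.2))
  simpa only [metric, div_eq_mul_inv] using
    ((((t1.fun_add t2).fun_sub t3).fun_add t4).fun_add t5).fun_add t6

theorem metric_eq_sum (x u v : Coord) : S.metric x u v = v.1 * S.metric x u Coord.ddt
    + ∑ i, v.2 i * S.metric x u ((0, EuclideanSpace.single i 1) : Coord) := by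
  conv_lhs => rw [Coord.eq_sum v]
  change S.flat x u _ = _ * S.flat x u _ + ∑ i, _ * S.flat x u _
  simp only [map_add, map_smul, map_sum, smul_eq_mul]

/-- The line `x + c A x` is the flow of the linear field `A` to first order, so this is the Lie
derivative `(L_A g)(u, u)`. -/
theorem hasDerivAt_metric_line (hx : x ∈ S.spacetime) (u : Coord) (A : Coord →L[ℝ] Coord) :
    HasDerivAt (fun c : ℝ => S.metric (x + c • A x) (u + c • A u) (u + c • A u))
      (fderiv ℝ (fun x => S.metric x u u) x (A x) + 2 * S.metric x u (A u)) 0 := by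
  have hl : HasDerivAt (fun c : ℝ => x + c • A x) (A x) 0 := by
    simpa using ((hasDerivAt_id (0 : ℝ)).smul_const (A x)).const_add x
  have hc : ∀ v w, HasDerivAt (fun c : ℝ => S.metric (x + c • A x) v w)
      (fderiv ℝ (fun x => S.metric x v w) x (A x)) 0 := by
    intro v w
    have h := (differentiableAt_metric hx v w).hasFDerivAt
    have h' : HasFDerivAt (fun x => S.metric x v w) (fderiv ℝ (fun x => S.metric x v w) x)
      (x + (0 : ℝ) • A x) := by simpa using h
    exact h'.comp_hasDerivAt (0 : ℝ) hl
  have h1 := (hc u u).add ((((hasDerivAt_id (0 : ℝ)).const_mul 2).mul (hc u (A u))).add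
    (((hasDerivAt_id (0 : ℝ)).pow 2).mul (hc (A u) (A u))))
  refine (h1.congr_deriv ?_).congr_of_eventuallyEq (Filter.Eventually.of_forall fun c => ?_)
  · simp
  · simp only [metric_add_right, metric_smul_right, S.metric_comm _ (u + c • A u), Pi.add_apply,
      Pi.mul_apply, Pi.pow_apply, id_eq]
    rw [S.metric_comm _ (c • A u) u, S.metric_comm _ (c • A u) (A u), metric_smul_right,
      metric_smul_right]
    ring

theorem fderiv_metric_ddt (hx : x ∈ S.spacetime) (u : Coord) :
    fderiv ℝ (fun x => S.metric x u u) x Coord.ddt = 0 := by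
  have hl : HasDerivAt (fun c : ℝ => x + c • Coord.ddt) Coord.ddt 0 := by
    simpa using ((hasDerivAt_id (0 : ℝ)).smul_const Coord.ddt).const_add x
  have h := (differentiableAt_metric hx u u).hasFDerivAt
  have h' : HasFDerivAt (fun x => S.metric x u u) (fderiv ℝ (fun x => S.metric x u u) x)
      (x + (0 : ℝ) • Coord.ddt) := by simpa using h
  refine (h'.comp_hasDerivAt (0 : ℝ) hl).unique ?_
  refine (hasDerivAt_const (0 : ℝ) (S.metric x u u)).congr_of_eventuallyEq
    (Filter.Eventually.of_forall fun c => ?_)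
  have e : (x + c • Coord.ddt).2 = x.2 := by simp [Coord.ddt]
  simp only [Function.comp_apply, metric, tauForm, rhoSq, deltaTheta, Coord.rad, Coord.cosSq,
    Coord.sinSq, Coord.dr, Coord.dphi, e]

/-- Killing's equation for `∂_φ` by parity: every scalar entering `g` is even in `c` along the
first-order rotation, and an even function has derivative `0` at `0`. -/
theorem fderiv_metric_rotation (hx : x ∈ S.spacetime) (u : Coord) :
    fderiv ℝ (fun x => S.metric x u u) x x.ddphi + 2 * S.metric x u u.ddphi = 0 := by
  have h := hasDerivAt_metric_line hx u Coord.rotation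
  simp only [Coord.rotation_apply] at h
  set F := fun c : ℝ => S.metric (x + c • x.ddphi) (u + c • u.ddphi) (u + c • u.ddphi) with hF
  have hev : (fun c => F (-c)) = F := by
    funext c
    have hrad : (x + (-c) • x.ddphi).rad = (x + c • x.ddphi).rad := by
      refine (sq_eq_sq₀ (norm_nonneg _) (norm_nonneg _)).1 ?_
      change (x + (-c) • x.ddphi).rad ^ 2 = (x + c • x.ddphi).rad ^ 2
      rw [Coord.rad_sq, Coord.rad_sq]
      simp [Coord.ddphi]; ring
    have hcos : (x + (-c) • x.ddphi).cosSq = (x + c • x.ddphi).cosSq := by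
      rw [Coord.cosSq, Coord.cosSq, hrad]; simp [Coord.ddphi]
    have hsin : (x + (-c) • x.ddphi).sinSq = (x + c • x.ddphi).sinSq := by
      rw [Coord.sinSq, Coord.sinSq, hrad]; congr 1; simp [Coord.ddphi]; ring
    have hdr : (x + (-c) • x.ddphi).dr (u + (-c) • u.ddphi)
        = (x + c • x.ddphi).dr (u + c • u.ddphi) := by
      rw [Coord.dr, Coord.dr, hrad, Coord.inner_eq, Coord.inner_eq]
      congr 1; simp [Coord.ddphi]; ring
    have hdp : (x + (-c) • x.ddphi).dphi (u + (-c) • u.ddphi)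
        = (x + c • x.ddphi).dphi (u + c • u.ddphi) := by
      rw [Coord.dphi, Coord.dphi, hrad]
      congr 1; simp [Coord.ddphi]; ring
    have hin : inner ℝ (u + (-c) • u.ddphi).2 (u + (-c) • u.ddphi).2
        = inner ℝ (u + c • u.ddphi).2 (u + c • u.ddphi).2 := by
      rw [Coord.inner_eq, Coord.inner_eq]
      simp [Coord.ddphi]; ring
    have h1 : ∀ d : ℝ, (u + d • u.ddphi).1 = u.1 := by intro d; simp [Coord.ddphi]
    simp only [hF, metric, tauForm, rhoSq, deltaTheta, hrad, hcos, hsin, hdr, hdp, hin, h1]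
  have h2 : HasDerivAt F (-(fderiv ℝ (fun x => S.metric x u u) x x.ddphi
      + 2 * S.metric x u u.ddphi)) 0 := by
    have h' : HasDerivAt F (fderiv ℝ (fun x => S.metric x u u) x x.ddphi
      + 2 * S.metric x u u.ddphi) (-(0 : ℝ)) := by rwa [neg_zero]
    have := h'.comp (0 : ℝ) (hasDerivAt_neg (0 : ℝ))
    rw [← hev]
    exact this.congr_deriv (by ring)
  linarith [h.unique h2]

variable (S) in
/-- `ρ²` times the derivative, in the direction `∂_r`, of `g(u, u)` at a null vector `u`. -/
noncomputable def radialForce (x u : Coord) : ℝ :=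
  -S.deltaR' x.rad / S.chi ^ 2 * S.tauForm x u ^ 2
  + 2 / S.chi * (deriv S.sFun x.rad * S.rhoSq x + 2 * x.rad * S.sFun x.rad
      + S.sFun x.rad * S.rhoSq x / x.rad) * (S.tauForm x u * x.dr u)
  - (deriv S.wFun x.rad * S.rhoSq x ^ 2 + 4 * x.rad * S.rhoSq x * S.wFun x.rad
      + 2 * S.rhoSq x ^ 2 * S.wFun x.rad / x.rad) * x.dr u ^ 2
  + 4 * x.rad / S.rhoSq x * S.angular x u
  - 4 * x.rad * S.deltaTheta x * S.a
      * (S.a * x.sinSq * u.1 - (x.rad ^ 2 + S.a ^ 2) * x.dphi u) * S.tauForm x u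
      / (S.chi ^ 2 * S.rhoSq x)

/-- The dilation generator is `r ∂_r`, and along it angles stay fixed while `r` and `dr` scale, so
`ρ² g` becomes an explicit function of one variable. Nullity removes the term in which `ρ²` is
differentiated. -/
theorem fderiv_metric_dilation (hx : x ∈ S.spacetime) {u : Coord} (hu : S.metric x u u = 0) :
    S.rhoSq x * (fderiv ℝ (fun x => S.metric x u u) x (Coord.dilation x)
      + 2 * S.metric x u (Coord.dilation u)) = x.rad * S.radialForce x u := by
  have hr := rad_pos hx
  have h1 := rhoSq_pos (S := S) hr
  have h2 := deltaTheta_pos (S := S) x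
  have h3 := S.chi_pos
  have h := hasDerivAt_metric_line hx u Coord.dilation
  have hq : HasDerivAt (fun c : ℝ => (1 + c) * x.rad) x.rad 0 := by
    simpa using ((hasDerivAt_id (0 : ℝ)).const_add 1).mul_const x.rad
  have q0 : (1 + (0 : ℝ)) * x.rad = x.rad := by ring
  set C := x.cosSq with hC
  set N := (inner ℝ u.2 u.2 - x.dr u ^ 2) / x.rad ^ 2 with hN
  -- the geometric quantities along the dilated line
  have hy : ∀ c : ℝ, (x + c • Coord.dilation x).2 = (1 + c) • x.2 := by
    intro c; simp [Coord.dilation_apply, add_smul]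
  have hv : ∀ c : ℝ, (u + c • Coord.dilation u).2 = (1 + c) • u.2 := by
    intro c; simp [Coord.dilation_apply, add_smul]
  have hv1 : ∀ c : ℝ, (u + c • Coord.dilation u).1 = u.1 := by
    intro c; simp [Coord.dilation_apply]
  have hrad : ∀ c : ℝ, 0 < 1 + c → (x + c • Coord.dilation x).rad = (1 + c) * x.rad := by
    intro c hc; rw [Coord.rad, hy, norm_smul, Real.norm_of_nonneg hc.le, Coord.rad]
  have hcos : ∀ c : ℝ, 0 < 1 + c → (x + c • Coord.dilation x).cosSq = C := by
    intro c hc; rw [hC, Coord.cosSq, hrad c hc, hy, Coord.cosSq]; simp; field_simp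
  have hsin : ∀ c : ℝ, 0 < 1 + c → (x + c • Coord.dilation x).sinSq = x.sinSq := by
    intro c hc; rw [Coord.sinSq, hrad c hc, hy, Coord.sinSq]; simp; field_simp
  have hdr : ∀ c : ℝ, 0 < 1 + c → (x + c • Coord.dilation x).dr (u + c • Coord.dilation u)
      = (1 + c) * x.dr u := by
    intro c hc
    rw [Coord.dr, hrad c hc, hy, hv, Coord.dr, inner_smul_left, inner_smul_right]; simp; field_simp
  have hdp : ∀ c : ℝ, 0 < 1 + c → (x + c • Coord.dilation x).dphi (u + c • Coord.dilation u)
      = x.dphi u := by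
    intro c hc; rw [Coord.dphi, hrad c hc, hy, hv, Coord.dphi]; simp; field_simp
  have hin : ∀ c : ℝ, inner ℝ (u + c • Coord.dilation u).2 (u + c • Coord.dilation u).2
      = (1 + c) ^ 2 * inner ℝ u.2 u.2 := by
    intro c; rw [hv, inner_smul_left, inner_smul_right]; simp; ring
  -- the derivative of the rescaled metric in two ways
  have hρ : HasDerivAt (fun q : ℝ => q ^ 2 + S.a ^ 2 * C) (2 * x.rad) x.rad := by
    simpa using (hasDerivAt_pow 2 x.rad).add_const (S.a ^ 2 * C)
  have ha : HasDerivAt (fun q : ℝ => q ^ 2 + S.a ^ 2) (2 * x.rad) x.rad := by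
    simpa using (hasDerivAt_pow 2 x.rad).add_const (S.a ^ 2)
  have hη : HasDerivAt (fun q : ℝ => q / x.rad * x.dr u) (1 / x.rad * x.dr u) x.rad :=
    ((hasDerivAt_id x.rad).div_const x.rad).mul_const _
  have hw : HasDerivAt (fun q : ℝ => (q ^ 2 + S.a ^ 2 * C) * (q / x.rad * x.dr u))
      (2 * x.rad * x.dr u + S.rhoSq x * (1 / x.rad * x.dr u)) x.rad := by
    refine (hρ.mul hη).congr_deriv ?_
    have : S.rhoSq x = x.rad ^ 2 + S.a ^ 2 * C := rfl
    rw [this]; field_simp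
  have hl : HasDerivAt (fun q : ℝ => 1 - S.lam * q ^ 2) (-(S.lam * (2 * x.rad))) x.rad := by
    simpa using ((hasDerivAt_pow 2 x.rad).const_mul S.lam).const_sub 1
  have hD := S.hasDerivAt_deltaR x.rad
  have hs := (S.differentiableAt_sFun x.rad).hasDerivAt
  have hW := (S.differentiableAt_wFun hx).hasDerivAt
  have hang : HasDerivAt (fun q : ℝ => S.deltaTheta x / S.chi ^ 2 *
        (S.a ^ 2 * x.sinSq * u.1 ^ 2 - 2 * S.a * (q ^ 2 + S.a ^ 2) * (u.1 * x.dphi u))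
      + S.a ^ 2 * (1 - S.lam * q ^ 2)
        * (S.deltaTheta x * (q ^ 2 + S.a ^ 2) + S.chi * (q ^ 2 + S.a ^ 2 * C))
        / (S.chi ^ 2 * S.deltaTheta x) * x.dphi u ^ 2
      + (q ^ 2 + S.a ^ 2 * C) ^ 2 / S.deltaTheta x * N)
      (4 * x.rad / S.rhoSq x * S.angular x u
        - 4 * x.rad * S.deltaTheta x * S.a
          * (S.a * x.sinSq * u.1 - (x.rad ^ 2 + S.a ^ 2) * x.dphi u) * S.tauForm x u
          / (S.chi ^ 2 * S.rhoSq x)) x.rad := by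
    have e := (((((ha.const_mul (2 * S.a)).mul_const (u.1 * x.dphi u)).const_sub
      (S.a ^ 2 * x.sinSq * u.1 ^ 2)).const_mul (S.deltaTheta x / S.chi ^ 2)).add
      ((((hl.const_mul (S.a ^ 2)).mul ((ha.const_mul (S.deltaTheta x)).add
        (hρ.const_mul S.chi))).div_const (S.chi ^ 2 * S.deltaTheta x)).mul_const
        (x.dphi u ^ 2))).add (((hρ.pow 2).div_const (S.deltaTheta x)).mul_const N)
    refine e.congr_deriv ?_
    have hx1 : S.chi = 1 + S.lam * S.a ^ 2 := rfl
    have hx2 : S.deltaTheta x = 1 + S.lam * S.a ^ 2 * C := rfl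
    have hx3 : S.rhoSq x = x.rad ^ 2 + S.a ^ 2 * C := rfl
    have hx4 : x.sinSq = 1 - C := by rw [hC, Coord.cosSq_eq hr]; ring
    simp only [angular, ← hN, Pi.add_apply, tauForm]
    generalize N = N at *
    generalize x.dphi u = p at *
    generalize u.1 = u1 at *
    rw [hx3] at h1 ⊢
    rw [hx2] at h2 ⊢
    rw [hx1] at h3 ⊢
    rw [hx4]
    field_simp
    ring
  have hG := (((hD.neg.div_const (S.chi ^ 2)).mul_const (S.tauForm x u ^ 2)).add
    (((hs.const_mul 2).div_const S.chi).mul (hw.const_mul (S.tauForm x u)))).sub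
    (hW.mul (hw.pow 2)) |>.add hang
  have hG' := (q0.symm ▸ hG).comp (0 : ℝ) hq
  have hρc := (q0.symm ▸ hρ).comp (0 : ℝ) hq
  have hm := hρc.mul h
  have hev : ∀ᶠ c : ℝ in nhds 0, 0 < 1 + c := by
    have : Filter.Tendsto (fun c : ℝ => 1 + c) (nhds 0) (nhds (1 + 0)) :=
      (continuous_const.add continuous_id).tendsto 0
    exact this.eventually (lt_mem_nhds (by norm_num))
  have hu' := hm.unique (hG'.congr_of_eventuallyEq (by
    filter_upwards [hev] with c hc
    have hR : 0 < (x + c • Coord.dilation x).rad := by rw [hrad c hc]; positivity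
    have := rhoSq_mul_metric (S := S) hR (u + c • Coord.dilation u)
    have hA : S.angular (x + c • Coord.dilation x) (u + c • Coord.dilation u)
        = S.deltaTheta x / S.chi ^ 2 *
        (S.a ^ 2 * x.sinSq * u.1 ^ 2
          - 2 * S.a * (((1 + c) * x.rad) ^ 2 + S.a ^ 2) * (u.1 * x.dphi u))
      + S.a ^ 2 * (1 - S.lam * ((1 + c) * x.rad) ^ 2)
        * (S.deltaTheta x * (((1 + c) * x.rad) ^ 2 + S.a ^ 2)
          + S.chi * (((1 + c) * x.rad) ^ 2 + S.a ^ 2 * C))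
        / (S.chi ^ 2 * S.deltaTheta x) * x.dphi u ^ 2
      + (((1 + c) * x.rad) ^ 2 + S.a ^ 2 * C) ^ 2 / S.deltaTheta x * N := by
      have e : (inner ℝ (u + c • Coord.dilation u).2 (u + c • Coord.dilation u).2
        - (x + c • Coord.dilation x).dr (u + c • Coord.dilation u) ^ 2)
        / (x + c • Coord.dilation x).rad ^ 2 = N := by
        rw [hin, hdr c hc, hrad c hc, hN]; field_simp
      rw [angular, e]
      simp only [deltaTheta, rhoSq, hcos c hc, hsin c hc, hdp c hc, hrad c hc, hv1, ← hC]
    rw [hA] at this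
    simp only [rhoSq, tauForm, hcos c hc, hdr c hc, hdp c hc, hrad c hc, hv1] at this
    simp only [Pi.mul_apply, Pi.add_apply, Pi.sub_apply, Pi.neg_apply, Pi.pow_apply,
      Function.comp_apply, tauForm]
    rw [this]
    field_simp
    ring))
  simp only [zero_smul, add_zero, hu, mul_zero, zero_add, one_mul, Pi.pow_apply,
       Function.comp_apply] at hu'
  have hx3 : x.rad ^ 2 + S.a ^ 2 * C = S.rhoSq x := rfl
  rw [hx3] at hu'
  rw [hu', radialForce]
  field_simp
  ring

end KerrDeSitter

/-! ### Constants of motion and the equation for the radial momentum. -/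

namespace KerrDeSitter

variable {S : KerrDeSitter} {γ u : ℝ → Coord} {J : Set ℝ} {τ : ℝ}

namespace IsNullGeodesic

/-- The geodesic equation is given for constant test vectors; expanding `A (γ τ)` in a fixed basis
extends it to linear fields, with the extra term `g(u, A u)`. -/
theorem hasDerivAt_metric (G : S.IsNullGeodesic γ u J) (hτ : τ ∈ J) (A : Coord →L[ℝ] Coord) :
    HasDerivAt (fun τ => S.metric (γ τ) (u τ) (A (γ τ)))
      (fderiv ℝ (fun x => S.metric x (u τ) (u τ)) (γ τ) (A (γ τ)) / 2
        + S.metric (γ τ) (u τ) (A (u τ))) τ := by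
  have hA : HasDerivAt (fun τ => A (γ τ)) (A (u τ)) τ := A.hasFDerivAt.comp_hasDerivAt τ
    (G.hasDerivAt τ hτ)
  have h0 : HasDerivAt (fun τ => (A (γ τ)).1) (A (u τ)).1 τ := hA.fst
  have h1 : ∀ i, HasDerivAt (fun τ => (A (γ τ)).2 i) ((A (u τ)).2 i) τ := fun i =>
    (EuclideanSpace.proj (𝕜 := ℝ) i).hasFDerivAt.comp_hasDerivAt τ hA.snd
  have hg := G.geodesic τ hτ
  have h := (h0.mul (hg Coord.ddt)).add (HasDerivAt.fun_sum fun i (_ : i ∈ Finset.univ) =>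
    (h1 i).mul (hg ((0, EuclideanSpace.single i 1) : Coord)))
  refine (h.congr_deriv ?_).congr_of_eventuallyEq
    (Filter.Eventually.of_forall fun τ => S.metric_eq_sum (γ τ) (u τ) (A (γ τ)) |>.trans ?_)
  · rw [S.metric_eq_sum (γ τ) (u τ) (A (u τ))]
    conv_rhs => rw [Coord.eq_sum (A (γ τ))]
    simp only [map_add, map_smul, map_sum, smul_eq_mul, Finset.sum_add_distrib, add_div,
      Finset.sum_div, mul_div_assoc]
    ring
  · simp

theorem hasDerivAt_energy (G : S.IsNullGeodesic γ u J) (hτ : τ ∈ J) :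
    HasDerivAt (fun τ => S.metric (γ τ) (u τ) Coord.ddt) 0 τ := by
  have := G.geodesic τ hτ Coord.ddt
  rwa [fderiv_metric_ddt (G.mem_spacetime τ hτ), zero_div] at this

theorem hasDerivAt_angularMomentum (G : S.IsNullGeodesic γ u J) (hτ : τ ∈ J) :
    HasDerivAt (fun τ => S.metric (γ τ) (u τ) (γ τ).ddphi) 0 τ := by
  refine (G.hasDerivAt_metric hτ Coord.rotation).congr_deriv ?_
  have := fderiv_metric_rotation (G.mem_spacetime τ hτ) (u τ)
  rw [Coord.rotation_apply, Coord.rotation_apply]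
  linarith

theorem hasDerivAt_dilation (G : S.IsNullGeodesic γ u J) (hτ : τ ∈ J) :
    HasDerivAt (fun τ => S.metric (γ τ) (u τ) (Coord.dilation (γ τ)))
      ((γ τ).rad * S.radialForce (γ τ) (u τ) / (2 * S.rhoSq (γ τ))) τ := by
  refine (G.hasDerivAt_metric hτ Coord.dilation).congr_deriv ?_
  have hx := G.mem_spacetime τ hτ
  have h1 := rhoSq_pos (S := S) (rad_pos hx)
  rw [← fderiv_metric_dilation hx (G.null τ hτ)]
  field_simp

theorem hasDerivAt_rad (G : S.IsNullGeodesic γ u J) (hτ : τ ∈ J) :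
    HasDerivAt (fun τ => (γ τ).rad) ((γ τ).dr (u τ)) τ :=
  Coord.hasDerivAt_rad (G.hasDerivAt τ hτ) (rad_pos (G.mem_spacetime τ hτ))

theorem eq_of_hasDerivAt_zero (G : S.IsNullGeodesic γ u J) {f : ℝ → ℝ}
    (hf : ∀ τ ∈ J, HasDerivAt f 0 τ) {s t : ℝ} (hs : s ∈ J) (ht : t ∈ J) : f s = f t :=
  G.isOpen.is_const_of_deriv_eq_zero G.ordConnected.isPreconnected
    (fun τ hτ => (hf τ hτ).differentiableAt.differentiableWithinAt) (fun τ hτ => (hf τ hτ).deriv)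
    hs ht

end IsNullGeodesic

theorem metric_ddr_eq_dilation (x u : Coord) :
    S.metric x u x.ddr = x.rad⁻¹ * S.metric x u (Coord.dilation x) := by
  rw [← metric_smul_right]
  congr 1
  simp [Coord.ddr, Coord.dilation_apply]

variable (S) in
/-- The value of `(r² + a²) ξ_t + a ξ_φ`, for given constants of motion `ξ_t` and `ξ_φ`. -/
noncomputable def principalMomentum (e l r : ℝ) : ℝ := (r ^ 2 + S.a ^ 2) * e + S.a * l

variable (S) in
/-- The numerator of the derivative of `P² / Δ_r`, up to the factor `P`, where
`P = (r² + a²) ξ_t + a ξ_φ`. -/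
noncomputable def radialSlope (e l r : ℝ) : ℝ :=
  4 * r * e * S.deltaR r - S.principalMomentum e l r * S.deltaR' r

variable (S) in
/-- `√Δ_r` times the radial Boyer–Lindquist component of `g_x(u, ·)`. -/
noncomputable def radialMomentum (e l : ℝ) (x u : Coord) : ℝ :=
  √(S.deltaR x.rad) * (S.metric x u (Coord.dilation x) / x.rad)
    + S.sFun x.rad * S.chi * S.principalMomentum e l x.rad / √(S.deltaR x.rad)

theorem metric_principal_eq_principalMomentum (x u : Coord) : S.metric x u (S.principal x)
    = S.principalMomentum (S.metric x u Coord.ddt) (S.metric x u x.ddphi) x.rad :=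
  metric_principal_eq u

theorem radialMomentum_eq {x u : Coord} (hx : S.InExterior x.rad) :
    S.radialMomentum (S.metric x u Coord.ddt) (S.metric x u x.ddphi) x u
      = S.rhoSq x * x.dr u / √(S.deltaR x.rad) := by
  have hr := hx.pos
  have hσ := Real.sqrt_pos.2 hx.deltaR_pos
  have hσ2 := Real.sq_sqrt hx.deltaR_pos.le
  have h3 := S.chi_pos
  have hs := S.sFun_sq_sub_one hx.rMinus_lt
  have hd := metric_ddr_eq_dilation (S := S) x u
  rw [metric_ddr hr] at hd
  have hd' : S.metric x u (Coord.dilation x) / x.rad = S.sFun x.rad / S.chi * S.tauForm x u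
      - S.rhoSq x * S.wFun x.rad * x.dr u := by rw [hd, div_eq_inv_mul]
  rw [radialMomentum, hd', ← metric_principal_eq_principalMomentum, metric_principal hr]
  set σ := √(S.deltaR x.rad)
  rw [← hσ2] at hs ⊢
  field_simp
  linear_combination (S.rhoSq x * x.dr u * S.chi) * hs

/-- The factor `√Δ_r` is chosen so that the angular part disappears: `ψ² = χ² P² / Δ_r - Θ`, with
`Θ` Carter's constant, so formally `2 ψ ψ' = χ² ∂_r (P² / Δ_r) r'` with `r' = √Δ_r ψ / ρ²`. The
direct computation also covers turning points. -/
theorem IsNullGeodesic.hasDerivAt_radialMomentum (G : S.IsNullGeodesic γ u J) (hτ : τ ∈ J)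
    (hx : S.InExterior (γ τ).rad) {e l : ℝ} (he : S.metric (γ τ) (u τ) Coord.ddt = e)
    (hl : S.metric (γ τ) (u τ) (γ τ).ddphi = l) :
    HasDerivAt (fun τ => S.radialMomentum e l (γ τ) (u τ))
      (S.chi ^ 2 * (S.principalMomentum e l (γ τ).rad * S.radialSlope e l (γ τ).rad) /
        (2 * S.rhoSq (γ τ) * (S.deltaR (γ τ).rad * √(S.deltaR (γ τ).rad)))) τ := by
  have hr := hx.pos
  have hD := hx.deltaR_pos
  have hσ := Real.sqrt_pos.2 hD
  have hσ2 := Real.sq_sqrt hD.le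
  have h1 := rhoSq_pos (S := S) hr
  have h2 := deltaTheta_pos (S := S) (γ τ)
  have h3 := S.chi_pos
  have hs := S.sFun_sq_sub_one hx.rMinus_lt
  have hs' := S.deriv_sFun_mul_sFun hx.rMinus_lt
  have hd := metric_ddr_eq_dilation (S := S) (γ τ) (u τ)
  rw [metric_ddr hr] at hd
  have hd' : S.metric (γ τ) (u τ) (Coord.dilation (γ τ)) = (γ τ).rad *
      (S.sFun (γ τ).rad / S.chi * S.tauForm (γ τ) (u τ)
      - S.rhoSq (γ τ) * S.wFun (γ τ).rad * (γ τ).dr (u τ)) := by rw [hd]; field_simp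
  have hp := metric_principal (S := S) hr (u τ)
  rw [metric_principal_eq_principalMomentum, he, hl] at hp
  have hE := metric_ddt (S := S) (x := γ τ) (u τ)
  rw [he] at hE
  have hn := rhoSq_mul_metric (S := S) hr (u τ)
  rw [G.null τ hτ, mul_zero] at hn
  have dr := G.hasDerivAt_rad hτ
  have dD' : HasDerivAt (fun τ => S.deltaR (γ τ).rad) (S.deltaR' (γ τ).rad * (γ τ).dr (u τ)) τ :=
    HasDerivAt.comp (h := fun τ => (γ τ).rad) τ (S.hasDerivAt_deltaR (γ τ).rad) dr
  have dD := dD'.sqrt hD.ne'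
  have ds := (S.differentiableAt_sFun (γ τ).rad).hasDerivAt.comp τ dr
  have dP : HasDerivAt (fun τ => S.principalMomentum e l (γ τ).rad)
      (2 * (γ τ).rad * (γ τ).dr (u τ) * e) τ := by
    exact ((((dr.fun_pow 2).add_const (S.a ^ 2)).mul_const e).add_const (S.a * l)).congr_deriv
      (by simp)
  have h := (dD.mul ((G.hasDerivAt_dilation hτ).div dr hr.ne')).add
    (((ds.mul_const S.chi).mul dP).div dD hσ.ne')
  refine h.congr_deriv ?_
  simp only [Pi.mul_apply, Pi.div_apply, Function.comp_apply]
  rw [hd', radialForce, radialSlope]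
  set P := S.principalMomentum e l (γ τ).rad
  set b := S.a * (γ τ).sinSq * (u τ).1 - ((γ τ).rad ^ 2 + S.a ^ 2) * (γ τ).dphi (u τ)
  set T := S.tauForm (γ τ) (u τ)
  set η := (γ τ).dr (u τ)
  set R := S.rhoSq (γ τ)
  set r := (γ τ).rad
  set s := S.sFun r
  set s' := deriv S.sFun r
  set w := S.wFun r
  set w' := deriv S.wFun r
  set D₁ := S.deltaR' r
  set X := S.chi
  -- Nullity eliminates the angular part, and `hb` trades the remaining angular velocity for `P` and
  -- `e`.
  have hΘ : S.angular (γ τ) (u τ) = S.deltaR r / X ^ 2 * T ^ 2 - 2 * s / X * (T * (R * η))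
      + w * (R * η) ^ 2 := by linear_combination -hn
  have hb : 4 * r * S.deltaTheta (γ τ) * S.a * b * T / (X ^ 2 * R)
      = 4 * r * T * (R * e - P) / R := by
    rw [hp, hE]
    field_simp
    ring
  rw [hΘ, hb]
  set σ := √(S.deltaR r)
  rw [← hσ2] at hs hs' hp ⊢
  have hw : w = (s ^ 2 - 1) / σ ^ 2 := by rw [hs]; field_simp
  have hw' : w' = (2 * s * s' - w * D₁) / σ ^ 2 := by rw [hs']; field_simp; ring
  rw [hw', hw, hp]
  clear_value σ D₁ s s' r R η T X
  field_simp
  ring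

/-! ### The trapping argument. -/

/-- One sign `ε` for all radii: `P² / Δ_r` increases where `P < 0` if the assumption is at `r_+`,
and decreases if it is at `r_c` or infinity. -/
theorem exists_sign_mul_radialSlope_pos {e l : ℝ}
    (h : 0 ≤ S.principalMomentum e l S.rPlus ∨ (S.lam = 0 ∧ 0 ≤ e) ∨
      (0 < S.lam ∧ 0 ≤ S.principalMomentum e l S.rC)) :
    ∃ ε : ℝ, |ε| = 1 ∧ ∀ r, S.InExterior r → S.principalMomentum e l r < 0 →
      0 < ε * (S.principalMomentum e l r * S.radialSlope e l r) := by
  rcases h with h | ⟨hl, h⟩ | ⟨hl, h⟩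
  · refine ⟨1, by simp, fun r hr hp => ?_⟩
    rw [one_mul]
    exact mul_pos_of_neg_of_neg hp (hr.mul_pos_of_rPlus h hp).2
  · refine ⟨-1, by simp, fun r hr hp => ?_⟩
    have : 0 < S.radialSlope e l r := hr.mul_pos_of_lam_eq_zero hl h hp
    linarith [mul_neg_of_neg_of_pos hp this]
  · refine ⟨-1, by simp, fun r hr hp => ?_⟩
    have : 0 < S.radialSlope e l r := (hr.mul_pos_of_rC hl h hp).2
    linarith [mul_neg_of_neg_of_pos hp this]

/-- Along a null geodesic which stays in a compact part of the exterior for an infinite time,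
`k = g(u, ·)` is positive on `principal` at some time, provided that it is nonnegative on the
generator of one of the horizons. -/
theorem IsNullGeodesic.exists_principal_pos (G : S.IsNullGeodesic γ u J) {I : Set ℝ} (hIJ : I ⊆ J)
    (hI : I.OrdConnected) (hunb : ∀ N : ℝ, ∃ s ∈ I, ∃ t ∈ I, N < t - s) {r₀ R₀ : ℝ}
    (h₀ : S.InExterior r₀) (h₁ : S.InExterior R₀)
    (hr : ∀ τ ∈ I, r₀ < (γ τ).rad ∧ (γ τ).rad < R₀) {e l : ℝ}
    (he : ∀ τ ∈ J, S.metric (γ τ) (u τ) Coord.ddt = e)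
    (hl : ∀ τ ∈ J, S.metric (γ τ) (u τ) (γ τ).ddphi = l)
    (hk : 0 ≤ S.principalMomentum e l S.rPlus ∨ (S.lam = 0 ∧ 0 ≤ e) ∨
      (0 < S.lam ∧ 0 ≤ S.principalMomentum e l S.rC)) :
    ∃ τ ∈ I, 0 < S.metric (γ τ) (u τ) (S.principal (γ τ)) := by
  by_contra! hneg
  have hext : ∀ r ∈ Set.Icc r₀ R₀, S.InExterior r := fun r h => h₀.of_le_of_le h₁ h.1 h.2
  have hIext : ∀ τ ∈ I, S.InExterior (γ τ).rad := fun τ hτ =>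
    hext _ ⟨(hr τ hτ).1.le, (hr τ hτ).2.le⟩
  have hPe : ∀ τ ∈ I, S.metric (γ τ) (u τ) (S.principal (γ τ))
      = S.principalMomentum e l (γ τ).rad := by
    intro τ hτ
    rw [metric_principal_eq_principalMomentum, he τ (hIJ hτ), hl τ (hIJ hτ)]
  have hP : ∀ τ ∈ I, S.principalMomentum e l (γ τ).rad < 0 := by
    intro τ hτ
    rw [← hPe τ hτ]
    exact lt_of_le_of_ne (hneg τ hτ) (principal_ne_zero (hIext τ hτ) (G.null τ (hIJ hτ))
      (G.velocity_ne_zero τ (hIJ hτ)))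
  obtain ⟨ε, hε, hsgn⟩ := exists_sign_mul_radialSlope_pos hk
  obtain ⟨τ₀, hτ₀, -⟩ := hunb 0
  have cP : Continuous (S.principalMomentum e l) := by unfold principalMomentum; fun_prop
  have cD : Continuous S.deltaR := by unfold deltaR; fun_prop
  have cD' : Continuous S.deltaR' := by unfold deltaR'; fun_prop
  have cf : Continuous (S.radialSlope e l) := by unfold radialSlope; fun_prop
  -- A compact set of pairs `(r, cos² θ)` containing the trapped end. The last condition is
  -- `deltaR_mul_sq_le` times `a²`, rewritten with `P - ρ² e = a (a sin² θ e + l)`.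
  set K : Set (ℝ × ℝ) := (Set.Icc r₀ R₀ ×ˢ Set.Icc 0 1) ∩
    {z | S.principalMomentum e l z.1 ≤ 0} ∩
    {z | S.deltaR z.1 * (S.principalMomentum e l z.1 - (z.1 ^ 2 + S.a ^ 2 * z.2) * e) ^ 2
      ≤ S.a ^ 2 * ((1 - z.2) * (1 + S.lam * S.a ^ 2 * z.2)) * S.principalMomentum e l z.1 ^ 2}
    with hKdef
  have hKc : IsCompact K := ((isCompact_Icc.prod isCompact_Icc).inter_right
    (isClosed_le (by fun_prop) continuous_const)).inter_right
    (isClosed_le (by fun_prop) (by fun_prop))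
  have hmem : ∀ τ ∈ I, ((γ τ).rad, (γ τ).cosSq) ∈ K := by
    intro τ hτ
    have hx := hIext τ hτ
    have hcs := Coord.cosSq_eq hx.pos
    refine ⟨⟨⟨⟨(hr τ hτ).1.le, (hr τ hτ).2.le⟩, (γ τ).cosSq_nonneg, ?_⟩, (hP τ hτ).le⟩, ?_⟩
    · linarith [(γ τ).sinSq_nonneg]
    · have := deltaR_mul_sq_le hx.rMinus_lt hx.deltaR_pos (G.null τ (hIJ hτ))
      rw [hPe τ hτ, he τ (hIJ hτ), hl τ (hIJ hτ)] at this
      have h := mul_le_mul_of_nonneg_left this (sq_nonneg S.a)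
      have e1 : S.principalMomentum e l (γ τ).rad - ((γ τ).rad ^ 2 + S.a ^ 2 * (γ τ).cosSq) * e
        = S.a * (S.a * (γ τ).sinSq * e + l) := by
        rw [hcs, principalMomentum]; ring
      have e2 : 1 - (γ τ).cosSq = (γ τ).sinSq := by rw [hcs]; ring
      simp only [Set.mem_ofPred_eq, e1, e2]
      simp only [deltaTheta] at h
      linarith
  have hKext : ∀ z ∈ K, S.InExterior z.1 := fun z hz => hext _ hz.1.1.1
  have hKneg : ∀ z ∈ K, S.principalMomentum e l z.1 < 0 := by
    intro z hz
    -- If `P = 0` at a point of `K`, the last condition forces `ρ² e = 0`, so `e = 0`; then `P` is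
    -- the constant `a l = 0`, contrary to `P < 0` at `τ₀`. Thus the closed condition `P ≤ 0` is
    -- automatically strict on `K`.
    refine lt_of_le_of_ne hz.1.2 fun h0 => ?_
    have hD := (hKext z hz).deltaR_pos
    have hzp := (hKext z hz).pos
    have h2 : 0 ≤ z.2 := hz.1.1.2.1
    have h := hz.2
    simp only [Set.mem_ofPred_eq, h0] at h
    have he0 : e = 0 := by
      by_contra he0
      have : 0 < S.deltaR z.1 * (0 - (z.1 ^ 2 + S.a ^ 2 * z.2) * e) ^ 2 := by
        have : 0 < z.1 ^ 2 + S.a ^ 2 * z.2 := by positivity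
        have : (0 - (z.1 ^ 2 + S.a ^ 2 * z.2) * e) ≠ 0 := by
          rw [zero_sub]; exact neg_ne_zero.2 (mul_ne_zero this.ne' he0)
        positivity
      linarith
    have := hP τ₀ hτ₀
    simp only [principalMomentum, he0] at this h0
    linarith
  -- `Φ` is `ψ'` as a function of `(r, cos² θ)`; the minimum of `ε Φ` on `K` is the uniform growth
  -- rate `m`.
  set Φ : ℝ × ℝ → ℝ := fun z => S.chi ^ 2 * (S.principalMomentum e l z.1 * S.radialSlope e l z.1) /
        (2 * (z.1 ^ 2 + S.a ^ 2 * z.2) * (S.deltaR z.1 * √(S.deltaR z.1))) with hΦ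
  have hden : ∀ z ∈ K, 0 < 2 * (z.1 ^ 2 + S.a ^ 2 * z.2) * (S.deltaR z.1 * √(S.deltaR z.1)) := by
    intro z hz
    have hD := (hKext z hz).deltaR_pos
    have hσ := Real.sqrt_pos.2 hD
    have hzp := (hKext z hz).pos
    have h2 : 0 ≤ z.2 := hz.1.1.2.1
    positivity
  have hΦc : ContinuousOn (fun z => ε * Φ z) K := by
    refine continuousOn_const.mul (ContinuousOn.div ?_ ?_ fun z hz => (hden z hz).ne')
    · fun_prop
    · fun_prop
  have hΦpos : ∀ z ∈ K, 0 < ε * Φ z := by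
    intro z hz
    have := hsgn z.1 (hKext z hz) (hKneg z hz)
    have h3 := S.chi_pos
    have e1 : ε * Φ z = S.chi ^ 2 * (ε * (S.principalMomentum e l z.1 * S.radialSlope e l z.1)) /
        (2 * (z.1 ^ 2 + S.a ^ 2 * z.2) * (S.deltaR z.1 * √(S.deltaR z.1))) := by
      rw [hΦ]; ring
    rw [e1]
    exact div_pos (by positivity) (hden z hz)
  obtain ⟨z₀, hz₀, hmin⟩ := hKc.exists_isMinOn ⟨_, hmem τ₀ hτ₀⟩ hΦc
  have hm := hΦpos z₀ hz₀
  set m := ε * Φ z₀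
  obtain ⟨M, hM⟩ := (isCompact_Icc (a := r₀) (b := R₀)).exists_bound_of_continuousOn
    (f := fun r => S.chi * S.principalMomentum e l r / √(S.deltaR r))
    (ContinuousOn.div (by fun_prop) (by fun_prop)
      fun r h => (Real.sqrt_pos.2 (hext r h).deltaR_pos).ne')
  have hψd : ∀ τ ∈ I, HasDerivAt (fun τ => ε * S.radialMomentum e l (γ τ) (u τ))
      (ε * Φ ((γ τ).rad, (γ τ).cosSq)) τ := fun τ hτ =>
    (G.hasDerivAt_radialMomentum (hIJ hτ) (hIext τ hτ) (he τ (hIJ hτ)) (hl τ (hIJ hτ))).const_mul ε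
  have hψb : ∀ τ ∈ I, |ε * S.radialMomentum e l (γ τ) (u τ)| ≤ M := by
    intro τ hτ
    have hx := hIext τ hτ
    have hσ := Real.sqrt_pos.2 hx.deltaR_pos
    refine le_trans ?_ (hM _ ⟨(hr τ hτ).1.le, (hr τ hτ).2.le⟩)
    have h := radialMomentum_eq (S := S) (u := u τ) hx
    rw [he τ (hIJ hτ), hl τ (hIJ hτ)] at h
    have hle : |S.rhoSq (γ τ) * (γ τ).dr (u τ)|
        ≤ |S.chi * S.principalMomentum e l (γ τ).rad| := by
      refine sq_le_sq.1 ?_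
      have := chi_sq_mul_principal_sq hx.rMinus_lt (G.null τ (hIJ hτ))
      rw [hPe τ hτ] at this
      rw [mul_pow S.chi, this]
      linarith [mul_nonneg hx.deltaR_pos.le (angular_nonneg (S := S) hx.pos (u τ))]
    rw [abs_mul, hε, one_mul, h, Real.norm_eq_abs, abs_div, abs_div]
    gcongr
  -- A function bounded by `M` in absolute value cannot grow at rate at least `m` for longer than `2
  -- M / m`.
  obtain ⟨s, hs, t, ht, hst⟩ := hunb (2 * |M| / m)
  have hst0 : s ≤ t := by
    have : 0 ≤ 2 * |M| / m := by positivity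
    linarith
  have hmv := hI.convex.mul_sub_le_image_sub_of_le_deriv
    (fun τ hτ => (hψd τ hτ).continuousAt.continuousWithinAt)
    (fun τ hτ => (hψd τ (interior_subset hτ)).differentiableAt.differentiableWithinAt)
    (C := m) (fun τ hτ => by
      rw [(hψd τ (interior_subset hτ)).deriv]
      exact hmin (hmem τ (interior_subset hτ))) s hs t ht hst0
  have b1 := (abs_le.1 (hψb s hs)).1
  have b2 := (abs_le.1 (hψb t ht)).2
  rw [div_lt_iff₀ hm] at hst
  linarith [le_abs_self M]

/-! ### Propagation of the sign along the geodesic, and conclusion. -/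

/-- Continuity of the velocity is not needed: the momenta along `∂_t`, `∂_φ` and the dilation field
are differentiable by the geodesic equation, and they determine `timeComponent`. -/
theorem IsNullGeodesic.continuousOn_timeComponent (G : S.IsNullGeodesic γ u J) :
    ContinuousOn (fun τ => S.timeComponent (γ τ) (u τ)) J := by
  intro τ hτ
  have hx := G.mem_spacetime τ hτ
  have cr := (G.hasDerivAt_rad hτ).continuousAt
  have cD : ContinuousAt (fun τ => S.deltaR (γ τ).rad) τ :=
    ((S.hasDerivAt_deltaR _).continuousAt).comp cr
  have cw : ContinuousAt (fun τ => S.wFun (γ τ).rad) τ :=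
    ContinuousAt.comp (f := fun τ => (γ τ).rad) (S.differentiableAt_wFun hx).continuousAt cr
  have cs : ContinuousAt (fun τ => S.sFun (γ τ).rad) τ :=
    ((S.differentiableAt_sFun _).continuousAt).comp cr
  have c1 := (G.hasDerivAt_energy hτ).continuousAt
  have c2 := (G.hasDerivAt_angularMomentum hτ).continuousAt
  have c3 := (G.hasDerivAt_dilation hτ).continuousAt
  have hr := (rad_pos hx).ne'
  have hd : 1 + S.deltaR (γ τ).rad ^ 2 ≠ 0 := by positivity
  simp only [timeComponent, timeCoeff, metric_principal_eq, metric_ddr_eq_dilation]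
  refine ContinuousAt.continuousWithinAt ?_
  fun_prop (disch := assumption)

theorem IsNullGeodesic.timeComponent_pos (G : S.IsNullGeodesic γ u J) {s t : ℝ} (hs : s ∈ J)
    (ht : t ∈ J) (h : 0 < S.timeComponent (γ s) (u s)) : 0 < S.timeComponent (γ t) (u t) := by
  by_contra! hneg
  obtain ⟨q, hq, h0⟩ := G.ordConnected.isPreconnected.intermediate_value ht hs
    G.continuousOn_timeComponent ⟨hneg, h.le⟩
  exact timeComponent_ne_zero (G.mem_spacetime q hq) (G.null q hq) (G.velocity_ne_zero q hq) h0

theorem IsNullGeodesic.futureNull (G : S.IsNullGeodesic γ u J) {I : Set ℝ} (hIJ : I ⊆ J)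
    (hI : I.OrdConnected) (hunb : ∀ N : ℝ, ∃ s ∈ I, ∃ t ∈ I, N < t - s) {r₀ R₀ : ℝ}
    (h₀ : S.InExterior r₀) (h₁ : S.InExterior R₀)
    (hr : ∀ τ ∈ I, r₀ < (γ τ).rad ∧ (γ τ).rad < R₀) {τ₀ : ℝ} (hτ₀ : τ₀ ∈ J)
    {k : Coord →L[ℝ] ℝ} (hk : S.IsFlat (γ τ₀) (u τ₀) k)
    (h : 0 ≤ k (S.vPlus (γ τ₀)) ∨ 0 ≤ k (S.vC (γ τ₀))) : S.FutureNull (γ τ₀) k := by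
  have hx := G.mem_spacetime τ₀ hτ₀
  refine ⟨hx, ⟨u τ₀, hk, G.null τ₀ hτ₀⟩, ?_⟩
  rw [hk]
  refine metric_timeOrientation_pos hx (G.null τ₀ hτ₀) (G.velocity_ne_zero τ₀ hτ₀) ?_
  obtain ⟨τ, hτ, hp⟩ := G.exists_principal_pos hIJ hI hunb h₀ h₁ hr
    (e := S.metric (γ τ₀) (u τ₀) Coord.ddt) (l := S.metric (γ τ₀) (u τ₀) (γ τ₀).ddphi)
    (fun τ hτ => G.eq_of_hasDerivAt_zero (fun τ hτ => G.hasDerivAt_energy hτ) hτ hτ₀)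
    (fun τ hτ => G.eq_of_hasDerivAt_zero (fun τ hτ => G.hasDerivAt_angularMomentum hτ) hτ hτ₀) (by
      -- Multiplying a horizon generator by `r² + a²`, with `r` the horizon radius, turns its
      -- pairing with `k` into `P(r)`, wherever the base point lies.
      have key : ∀ r : ℝ, 0 < r → 0 ≤ S.metric (γ τ₀) (u τ₀) (Coord.ddt
          + (S.a / (r ^ 2 + S.a ^ 2)) • (γ τ₀).ddphi) →
          0 ≤ S.principalMomentum (S.metric (γ τ₀) (u τ₀) Coord.ddt)
            (S.metric (γ τ₀) (u τ₀) (γ τ₀).ddphi) r := by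
        intro r hr h
        rw [metric_add_right, metric_smul_right] at h
        have hA : 0 < r ^ 2 + S.a ^ 2 := by positivity
        have := mul_nonneg hA.le h
        rw [principalMomentum]
        field_simp at this
        linarith
      have hq := S.rMinus_pos.trans S.rMinus_lt_rPlus
      rw [hk, hk, vPlus, vC] at h
      rcases h with h | h
      · exact Or.inl (key _ hq h)
      · rcases S.lam_eq_zero_or_pos with hl | hl
        · refine Or.inr (Or.inl ⟨hl, ?_⟩)
          simpa [hl] using h
        · rw [if_neg hl.ne'] at h
          exact Or.inr (Or.inr ⟨hl, key _ (hq.trans (S.rPlus_lt_rC hl)) h⟩))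
  have hx' : S.InExterior (γ τ).rad := h₀.of_le_of_le h₁ (hr τ hτ).1.le (hr τ hτ).2.le
  exact G.timeComponent_pos (hIJ hτ) hτ₀ (timeComponent_pos_of_principal_pos hx'
    (G.null τ (hIJ hτ)) (G.velocity_ne_zero τ (hIJ hτ)) hp)

theorem GammaPlus.futureNull {x : Coord} {k : Coord →L[ℝ] ℝ} (hΓ : S.GammaPlus x k)
    (h : 0 ≤ k (S.vPlus x) ∨ 0 ≤ k (S.vC x)) : S.FutureNull x k := by
  obtain ⟨γ, u, J, G, ⟨τ₀, hτ₀, rfl, hk⟩, hJ, r₀, R₀, T, h₀, h₁, hr⟩ := hΓ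
  refine G.futureNull (I := J ∩ Set.Ioi T) Set.inter_subset_left
    (G.ordConnected.inter Set.ordConnected_Ioi) (fun N => ?_) h₀ h₁
    (fun τ hτ => hr τ hτ.1 hτ.2) hτ₀ hk h
  rw [not_bddAbove_iff] at hJ
  obtain ⟨s, hs, hs'⟩ := hJ T
  obtain ⟨t, ht, ht'⟩ := hJ (max T (s + N))
  exact ⟨s, ⟨hs, hs'⟩, t, ⟨ht, (le_max_left _ _).trans_lt ht'⟩, by
    linarith [(le_max_right T (s + N)).trans_lt ht']⟩

theorem GammaMinus.futureNull {x : Coord} {k : Coord →L[ℝ] ℝ} (hΓ : S.GammaMinus x k)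
    (h : 0 ≤ k (S.vPlus x) ∨ 0 ≤ k (S.vC x)) : S.FutureNull x k := by
  obtain ⟨γ, u, J, G, ⟨τ₀, hτ₀, rfl, hk⟩, hJ, r₀, R₀, T, h₀, h₁, hr⟩ := hΓ
  refine G.futureNull (I := J ∩ Set.Iio T) Set.inter_subset_left
    (G.ordConnected.inter Set.ordConnected_Iio) (fun N => ?_) h₀ h₁
    (fun τ hτ => hr τ hτ.1 hτ.2) hτ₀ hk h
  rw [not_bddBelow_iff] at hJ
  obtain ⟨t, ht, ht'⟩ := hJ T
  obtain ⟨s, hs, hs'⟩ := hJ (min T (t - N))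
  exact ⟨s, ⟨hs, hs'.trans_le (min_le_left _ _)⟩, t, ⟨ht, ht'⟩, by
    linarith [hs'.trans_le (min_le_right T (t - N))]⟩

end KerrDeSitter

theorem mainTheorem2 :
    (∃ ε : ℝ, 0 < ε ∧ ∀ a : ℝ, (ε : EReal) ≤ KerrDeSitter.lambda0 a) ∧
    ∀ S : KerrDeSitter, (S.lam : EReal) < KerrDeSitter.lambda0 S.a →
      ∀ (x : Coord) (k : Coord →L[ℝ] ℝ), S.GammaPlus x k ∨ S.GammaMinus x k →
        0 ≤ k (S.vPlus x) ∨ 0 ≤ k (S.vC x) → S.FutureNull x k := by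
  refine ⟨⟨1 / 64, by norm_num, KerrDeSitter.le_lambda0⟩, fun S _ x k hΓ h => ?_⟩
  rcases hΓ with hΓ | hΓ
  · exact hΓ.futureNull h
  · exact hΓ.futureNull h
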